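/- Let $(A,\mathscr A,\mu)$ and $(B,\mathscr B,\nu)$ be probability spaces, let $\mathscr F$ be a sub-$\sigma$-algebra of the product $\sigma$-algebra $\mathscr A\times\mathscr B$, let $1<p,q<\infty$ with conjugate exponents $p',q'$ (so $\frac1p+\frac1{p'}=1$ and $\frac1q+\frac1{q'}=1$), and let $X$ be a non-zero Banach space over the scalar field $\mathbb K\in\{\mathbb R,\mathbb C\}$. Elements of $L^p(\mu;L^q(\nu;X))$ are identified with the functions in $L^1(\mu\times\nu;X)$ that represent them. Write $L^p_{\mathscr F}(\mu;L^q(\nu))$ for the subspace of $L^p(\mu;L^q(\nu))=L^p(\mu;L^q(\nu;\mathbb K))$ of those elements which have a strongly $\mathscr F$-measurable representative on $A\times B$, and for $f\in L^p_{\mathscr F}(\mu;L^q(\nu))$ let $\phi_f\in (L^{p'}_{\mathscr F}(\mu;L^{q'}(\nu)))^*$ be the functional $$\phi_f(g)=\int_A\int_B f g\,\mathrm d\nu\,\mathrm d\mu .$$ Then the following assertions are equivalent: 1. the conditional expectation operator $\mathbb E(\cdot|\mathscr F)$ on $L^1(\mu\times\nu;X)$ restricts to a bounded projection on $L^p(\mu;L^q(\nu;X))$;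 2. the conditional expectation operator $\mathbb E(\cdot|\mathscr F)$ on $L^1(\mu\times\nu;X)$ restricts to a bounded projection on $L^{p'}(\mu;L^{q'}(\nu;X))$; 3. the map $f\mapsto\phi_f$ is an isomorphism of Banach spaces (a linear homeomorphism, not necessarily isometric) from $L^p_{\mathscr F}(\mu;L^q(\nu))$ onto $(L^{p'}_{\mathscr F}(\mu;L^{q'}(\nu)))^*$. -/

import Mathlib

open MeasureTheory
open scoped ENNReal

noncomputable section

/-- The function `f` on `A × B` is a representative of the element `u` of the Bochner space
`L^p(μ; L^q(ν; X))`: for `μ`-almost all `a`, the section `f (a, ·)` is a representative of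
`u a ∈ L^q(ν; X)`. -/
def IsRep {A B X : Type*} [MeasurableSpace A] [MeasurableSpace B] [NormedAddCommGroup X]
    {μ : Measure A} {ν : Measure B} {p q : ℝ≥0∞} [Fact (1 ≤ q)]
    (f : A × B → X) (u : Lp (Lp X q ν) p μ) : Prop :=
  ∀ᵐ a ∂μ, ∀ᵐ b ∂ν, (u a : Lp X q ν) b = f (a, b)

/-- `L^p_F(μ; L^q(ν; X))`: the subspace of those elements of `L^p(μ; L^q(ν; X))` which have a
strongly `F`-measurable representative. -/
def LpF (𝕜 : Type*) [RCLike 𝕜] {A B : Type*} [MeasurableSpace A] [MeasurableSpace B]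
    (F : MeasurableSpace (A × B)) (μ : Measure A) (ν : Measure B)
    (X : Type*) [NormedAddCommGroup X] [NormedSpace 𝕜 X]
    (p q : ℝ≥0∞) [Fact (1 ≤ p)] [Fact (1 ≤ q)] :
    Submodule 𝕜 (Lp (Lp X q ν) p μ) where
  carrier := {u | ∃ f : A × B → X, StronglyMeasurable[F] f ∧ IsRep f u}
  zero_mem' := by
    refine ⟨fun _ => 0, stronglyMeasurable_const, ?_⟩
    filter_upwards [Lp.coeFn_zero (Lp X q ν) p μ] with a ha
    rw [ha]
    filter_upwards [Lp.coeFn_zero X q ν] with b hb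
    exact hb
  add_mem' := by
    rintro u v ⟨f, hf, hu⟩ ⟨g, hg, hv⟩
    refine ⟨f + g, hf.add hg, ?_⟩
    filter_upwards [Lp.coeFn_add u v, hu, hv] with a ha hua hva
    rw [ha, Pi.add_apply]
    filter_upwards [Lp.coeFn_add (u a) (v a), hua, hva] with b hb hub hvb
    rw [hb, Pi.add_apply, hub, hvb, Pi.add_apply]
  smul_mem' := by
    rintro c u ⟨f, hf, hu⟩
    refine ⟨c • f, hf.const_smul c, ?_⟩
    filter_upwards [Lp.coeFn_smul c u, hu] with a ha hua
    rw [ha, Pi.smul_apply]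
    filter_upwards [Lp.coeFn_smul c (u a), hua] with b hb hub
    rw [hb, Pi.smul_apply, hub, Pi.smul_apply]

/-- The conditional expectation `E(· | F)` on `L^1(μ × ν; X)` restricts to a bounded projection on
`L^p(μ; L^q(ν; X))`. Elements of the mixed space are identified with elements of `L^1(μ × ν; X)`
through jointly integrable representatives, which are unique up to a `μ × ν`-null set. -/
def CondExpRestrictsToProjection (𝕜 : Type*) [RCLike 𝕜]
    {A B : Type*} [MeasurableSpace A] [MeasurableSpace B]
    (F : MeasurableSpace (A × B)) (μ : Measure A) (ν : Measure B)
    (X : Type*) [NormedAddCommGroup X] [NormedSpace ℝ X] [NormedSpace 𝕜 X] [CompleteSpace X]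
    (p q : ℝ≥0∞) [Fact (1 ≤ p)] [Fact (1 ≤ q)] : Prop :=
  ∃ P : Lp (Lp X q ν) p μ →L[𝕜] Lp (Lp X q ν) p μ,
    P ∘L P = P ∧
    ∀ u : Lp (Lp X q ν) p μ, ∃ f : A × B → X,
      Integrable f (μ.prod ν) ∧ IsRep f u ∧ IsRep ((μ.prod ν)[f | F]) (P u)

/-- The bilinear pairing `⟨f, g⟩ = ∫ ∫ f g dν dμ` of `L^p(μ; L^q(ν))` and
`L^{p'}(μ; L^{q'}(ν))`. -/
def mixedPairing (𝕜 : Type*) [RCLike 𝕜] {A B : Type*} [MeasurableSpace A] [MeasurableSpace B]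
    (μ : Measure A) (ν : Measure B) (p q p' q' : ℝ≥0∞)
    [Fact (1 ≤ p)] [Fact (1 ≤ q)] [Fact (1 ≤ p')] [Fact (1 ≤ q')]
    [ENNReal.HolderConjugate p p'] [ENNReal.HolderConjugate q q'] :
    Lp (Lp 𝕜 q ν) p μ →L[𝕜] Lp (Lp 𝕜 q' ν) p' μ →L[𝕜] 𝕜 :=
  ((ContinuousLinearMap.mul 𝕜 𝕜).lpPairing ν q q').lpPairing μ p p'

theorem mixedPairing_apply (𝕜 : Type*) [RCLike 𝕜]
    {A B : Type*} [MeasurableSpace A] [MeasurableSpace B]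
    (μ : Measure A) (ν : Measure B) (p q p' q' : ℝ≥0∞)
    [Fact (1 ≤ p)] [Fact (1 ≤ q)] [Fact (1 ≤ p')] [Fact (1 ≤ q')]
    [ENNReal.HolderConjugate p p'] [ENNReal.HolderConjugate q q']
    (f : Lp (Lp 𝕜 q ν) p μ) (g : Lp (Lp 𝕜 q' ν) p' μ) :
    mixedPairing 𝕜 μ ν p q p' q' f g =
      ∫ a, ∫ b, (f a : Lp 𝕜 q ν) b * (g a : Lp 𝕜 q' ν) b ∂ν ∂μ := by
  simp only [mixedPairing, ContinuousLinearMap.lpPairing_eq_integral,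
    ContinuousLinearMap.mul_apply']

/-- The canonical map `f ↦ φ_f` from `L^p_F(μ; L^q(ν))` to the dual of `L^{p'}_F(μ; L^{q'}(ν))`,
where `φ_f g = ∫ ∫ f g dν dμ`. -/
def phi (𝕜 : Type*) [RCLike 𝕜] {A B : Type*} [MeasurableSpace A] [MeasurableSpace B]
    (F : MeasurableSpace (A × B)) (μ : Measure A) (ν : Measure B) (p q p' q' : ℝ≥0∞)
    [Fact (1 ≤ p)] [Fact (1 ≤ q)] [Fact (1 ≤ p')] [Fact (1 ≤ q')]
    [ENNReal.HolderConjugate p p'] [ENNReal.HolderConjugate q q'] :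
    LpF 𝕜 F μ ν 𝕜 p q →L[𝕜] StrongDual 𝕜 (LpF 𝕜 F μ ν 𝕜 p' q') :=
  (mixedPairing 𝕜 μ ν p q p' q').bilinearComp
    (LpF 𝕜 F μ ν 𝕜 p q).subtypeL (LpF 𝕜 F μ ν 𝕜 p' q').subtypeL

theorem phi_apply (𝕜 : Type*) [RCLike 𝕜] {A B : Type*} [MeasurableSpace A] [MeasurableSpace B]
    (F : MeasurableSpace (A × B)) (μ : Measure A) (ν : Measure B) (p q p' q' : ℝ≥0∞)
    [Fact (1 ≤ p)] [Fact (1 ≤ q)] [Fact (1 ≤ p')] [Fact (1 ≤ q')]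
    [ENNReal.HolderConjugate p p'] [ENNReal.HolderConjugate q q']
    (f : LpF 𝕜 F μ ν 𝕜 p q) (g : LpF 𝕜 F μ ν 𝕜 p' q') :
    phi 𝕜 F μ ν p q p' q' f g =
      ∫ a, ∫ b, ((f : Lp (Lp 𝕜 q ν) p μ) a : Lp 𝕜 q ν) b *
        ((g : Lp (Lp 𝕜 q' ν) p' μ) a : Lp 𝕜 q' ν) b ∂ν ∂μ :=
  mixedPairing_apply 𝕜 μ ν p q p' q' f g

end

/-! Boundedness of the conditional expectation `E` on a mixed-norm space depends neither on `X` nor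
on which of the two conjugate pairs of exponents is taken; both facts come from positivity and
duality. From `X` to scalars: apply `E` to `s • x` with a fixed `x ≠ 0` and `s ≥ 0` bounded
(`CondExpRestrictsToProjection.condExpMixedBound`). From scalars with exponents `p', q'` to any `X`
with exponents `p, q`: the inequality `‖E f‖ ≤ E ‖f‖`, the symmetry of `E` and Hölder give `∫ s ‖E
f‖ ≤ ∫ (E s) ‖f‖ ≤ C ‖s‖ ‖f‖`, and the converse of Hölder's inequality for mixed norms turns this
into a bound for `E f` (`mixedNorm_condExp_le_of_conjugate`). Alternating the two steps gives 1 ⇔ 2,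
for all `X` at once. For 3, `L^p(μ; L^q(ν))` is the dual of `L^{p'}(μ; L^{q'}(ν))`
(`exists_eq_mixedPairing`, by Radon–Nikodym and converse Hölder). If `E` is bounded on both spaces,
it gives mutually adjoint projections onto the `F`-measurable subspaces, so the duality descends to
them (`isInvertible_phi`). Conversely, if `φ` is invertible, the functional `g ↦ ∫ s g` on the
`F`-measurable subspace is `φ_w` for some `w` with `‖w‖ ≤ D ‖s‖`; testing on indicators of sets in
`F` shows `w = E s`, which is the scalar bound (`condExpMixedBound_of_isInvertible_phi`). -/

open Filter Topology NNReal symmDiff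

/-! ### Mixed norms of functions on the product: Hölder and comparison with `L^r(μ × ν)`. -/

section Basic

variable {A B X : Type*} [MeasurableSpace A] [MeasurableSpace B]

/-- The norm of `L^p(μ; L^q(ν; X))`, for functions on `A × B`. -/
noncomputable def mixedNorm {E : Type*} [ENorm E] (p q : ℝ≥0∞) (μ : Measure A) (ν : Measure B)
    (f : A × B → E) : ℝ≥0∞ :=
  eLpNorm (fun a => eLpNorm (fun b => f (a, b)) q ν) p μ

section MixedNorm

variable {E E' : Type*} {μ : Measure A} {ν : Measure B} {p q : ℝ≥0∞}

theorem mixedNorm_mono_ae [ENorm E] [ENorm E'] [SFinite ν] {f : A × B → E} {g : A × B → E'}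
    (h : ∀ᵐ z ∂μ.prod ν, ‖f z‖ₑ ≤ ‖g z‖ₑ) : mixedNorm p q μ ν f ≤ mixedNorm p q μ ν g := by
  refine eLpNorm_mono_enorm_ae ?_
  filter_upwards [Measure.ae_ae_of_ae_prod h] with a ha
  exact eLpNorm_mono_enorm_ae ha

theorem mixedNorm_congr_enorm_ae [ENorm E] [ENorm E'] [SFinite ν] {f : A × B → E}
    {g : A × B → E'} (h : ∀ᵐ z ∂μ.prod ν, ‖f z‖ₑ = ‖g z‖ₑ) :
    mixedNorm p q μ ν f = mixedNorm p q μ ν g :=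
  le_antisymm (mixedNorm_mono_ae (h.mono fun _ h => h.le))
    (mixedNorm_mono_ae (h.mono fun _ h => h.ge))

theorem mixedNorm_enorm [ENorm E] [SFinite ν] (f : A × B → E) :
    mixedNorm p q μ ν (fun z => ‖f z‖ₑ) = mixedNorm p q μ ν f :=
  mixedNorm_congr_enorm_ae (by simp)

theorem aemeasurable_eLpNorm_section [ENorm E] [SFinite ν] {f : A × B → E}
    (hf : AEMeasurable (fun z => ‖f z‖ₑ) (μ.prod ν)) (hq0 : q ≠ 0) (hq : q ≠ ∞) :
    AEMeasurable (fun a => eLpNorm (fun b => f (a, b)) q ν) μ := by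
  simp only [eLpNorm_eq_lintegral_rpow_enorm_toReal hq0 hq]
  exact ((hf.pow_const q.toReal).lintegral_prod_right').pow_const _

theorem lintegral_mul_le_eLpNorm_mul_eLpNorm {α : Type*} [MeasurableSpace α] {m : Measure α}
    (p p' : ℝ≥0∞) [p.HolderConjugate p'] (hp : 1 < p) (hp_top : p < ∞) {f g : α → ℝ≥0∞}
    (hf : AEMeasurable f m) (hg : AEMeasurable g m) :
    ∫⁻ x, f x * g x ∂m ≤ eLpNorm f p m * eLpNorm g p' m := by
  have : p'.HolderConjugate p := .symm
  have h0 : p' ≠ 0 := ENNReal.HolderConjugate.ne_zero p' p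
  have ht : p' ≠ ∞ := ((ENNReal.HolderConjugate.lt_top_iff_one_lt p' p).2 hp).ne
  have hpp : p.toReal.HolderConjugate p'.toReal :=
    ENNReal.HolderConjugate.toReal_of_ne_top hp_top.ne ht
  rw [eLpNorm_eq_lintegral_rpow_enorm_toReal (zero_lt_one.trans hp).ne' hp_top.ne,
    eLpNorm_eq_lintegral_rpow_enorm_toReal h0 ht]
  simpa using ENNReal.lintegral_mul_le_Lp_mul_Lq m hpp hf hg

/-- Hölder's inequality for mixed norms. -/
theorem lintegral_mul_le_mixedNorm_mul_mixedNorm [SFinite ν] (p q p' q' : ℝ≥0∞)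
    [p.HolderConjugate p'] [q.HolderConjugate q'] (hp : 1 < p) (hp_top : p < ∞)
    (hq : 1 < q) (hq_top : q < ∞) {f g : A × B → ℝ≥0∞}
    (hf : AEMeasurable f (μ.prod ν)) (hg : AEMeasurable g (μ.prod ν)) :
    ∫⁻ z, f z * g z ∂μ.prod ν ≤ mixedNorm p q μ ν f * mixedNorm p' q' μ ν g := by
  have : q'.HolderConjugate q := .symm
  have h0 : q' ≠ 0 := ENNReal.HolderConjugate.ne_zero q' q
  have ht : q' ≠ ∞ := ((ENNReal.HolderConjugate.lt_top_iff_one_lt q' q).2 hq).ne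
  rw [lintegral_prod (fun z => f z * g z) (hf.mul hg)]
  refine (lintegral_mono_ae ?_).trans
    (lintegral_mul_le_eLpNorm_mul_eLpNorm p p' hp hp_top
      (aemeasurable_eLpNorm_section (by simpa using hf) (zero_lt_one.trans hq).ne' hq_top.ne)
      (aemeasurable_eLpNorm_section (q := q') (by simpa using hg) h0 ht))
  filter_upwards [hf.aestronglyMeasurable.prodMk_left,
    hg.aestronglyMeasurable.prodMk_left] with a hfa hga
  exact lintegral_mul_le_eLpNorm_mul_eLpNorm q q' hq hq_top hfa.aemeasurable hga.aemeasurable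

theorem mixedNorm_self [ENorm E] [SFinite ν] {f : A × B → E}
    (hf : AEMeasurable (fun z => ‖f z‖ₑ) (μ.prod ν)) (hp0 : p ≠ 0) (hp : p ≠ ∞) :
    mixedNorm p p μ ν f = eLpNorm f p (μ.prod ν) := by
  have hp1 : 0 < p.toReal := ENNReal.toReal_pos hp0 hp
  simp only [mixedNorm, eLpNorm_eq_lintegral_rpow_enorm_toReal hp0 hp, enorm_eq_self]
  rw [lintegral_prod _ (hf.pow_const _)]
  simp only [← ENNReal.rpow_mul, one_div, inv_mul_cancel₀ hp1.ne', ENNReal.rpow_one]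

theorem mixedNorm_mono_exponent [NormedAddCommGroup E] [IsProbabilityMeasure μ]
    [IsProbabilityMeasure ν] {f : A × B → E} (hf : AEStronglyMeasurable f (μ.prod ν))
    {p₂ q₂ : ℝ≥0∞} (hp : p ≤ p₂) (hq : q ≤ q₂) (hq0 : q ≠ 0) (hq_top : q ≠ ∞) :
    mixedNorm p q μ ν f ≤ mixedNorm p₂ q₂ μ ν f := by
  refine (eLpNorm_le_eLpNorm_of_exponent_le hp
    (aemeasurable_eLpNorm_section hf.enorm hq0 hq_top).aestronglyMeasurable).trans ?_
  refine eLpNorm_mono_enorm_ae ?_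
  filter_upwards [hf.prodMk_left] with a ha
  exact eLpNorm_le_eLpNorm_of_exponent_le hq ha

theorem eLpNorm_one_le_mixedNorm [NormedAddCommGroup E] [IsProbabilityMeasure μ]
    [IsProbabilityMeasure ν] {f : A × B → E} (hf : AEStronglyMeasurable f (μ.prod ν))
    (hp : 1 ≤ p) (hq : 1 ≤ q) : eLpNorm f 1 (μ.prod ν) ≤ mixedNorm p q μ ν f := by
  rw [← mixedNorm_self hf.enorm one_ne_zero ENNReal.one_ne_top]
  exact mixedNorm_mono_exponent hf hp hq one_ne_zero ENNReal.one_ne_top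

theorem mixedNorm_le_eLpNorm_max [NormedAddCommGroup E] [IsProbabilityMeasure μ]
    [IsProbabilityMeasure ν] {f : A × B → E} (hf : AEStronglyMeasurable f (μ.prod ν))
    (hp : p ≠ ∞) (hq0 : q ≠ 0) (hq : q ≠ ∞) :
    mixedNorm p q μ ν f ≤ eLpNorm f (max p q) (μ.prod ν) := by
  rw [← mixedNorm_self hf.enorm (by simp [hq0]) (by simp [hp, hq])]
  exact mixedNorm_mono_exponent hf (le_max_left _ _) (le_max_right _ _) hq0 hq

theorem integrable_of_mixedNorm_lt_top [NormedAddCommGroup E] [IsProbabilityMeasure μ]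
    [IsProbabilityMeasure ν] {f : A × B → E} (hf : AEStronglyMeasurable f (μ.prod ν))
    (hp : 1 ≤ p) (hq : 1 ≤ q) (h : mixedNorm p q μ ν f < ∞) : Integrable f (μ.prod ν) :=
  memLp_one_iff_integrable.1 ⟨hf, (eLpNorm_one_le_mixedNorm hf hp hq).trans_lt h⟩

theorem mixedNorm_le_of_bound [NormedAddCommGroup E] [IsProbabilityMeasure μ]
    [IsProbabilityMeasure ν] {f : A × B → E} {C : ℝ} (h : ∀ᵐ z ∂μ.prod ν, ‖f z‖ ≤ C) :
    mixedNorm p q μ ν f ≤ ENNReal.ofReal C := by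
  have h1 : ∀ᵐ a ∂μ, ‖eLpNorm (fun b => f (a, b)) q ν‖ₑ ≤ ENNReal.ofReal C := by
    filter_upwards [Measure.ae_ae_of_ae_prod h] with a ha
    simpa using eLpNorm_le_of_ae_bound (p := q) ha
  refine (eLpNorm_mono_enorm_ae (g := fun _ => ENNReal.ofReal C) (by simpa using h1)).trans ?_
  rcases eq_or_ne p 0 with rfl | hp
  · simp
  · rw [eLpNorm_const _ hp (IsProbabilityMeasure.ne_zero μ)]
    simp

theorem mixedNorm_lt_top_of_bound [NormedAddCommGroup E] [IsProbabilityMeasure μ]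
    [IsProbabilityMeasure ν] {f : A × B → E} {C : ℝ} (h : ∀ᵐ z ∂μ.prod ν, ‖f z‖ ≤ C) :
    mixedNorm p q μ ν f < ∞ :=
  (mixedNorm_le_of_bound h).trans_lt ENNReal.ofReal_lt_top

end MixedNorm

/-! ### Uniqueness and algebra of representatives. -/

section IsRep

variable [NormedAddCommGroup X] {μ : Measure A} {ν : Measure B} {p q : ℝ≥0∞} [Fact (1 ≤ q)]

theorem IsRep.mixedNorm_eq {f : A × B → X} {u : Lp (Lp X q ν) p μ} (h : IsRep f u) :
    mixedNorm p q μ ν f = ‖u‖ₑ := by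
  rw [Lp.enorm_def]
  refine eLpNorm_congr_enorm_ae ?_
  filter_upwards [h] with a ha
  rw [Lp.enorm_def, enorm_eq_self]
  exact (eLpNorm_congr_ae ha).symm

theorem IsRep.congr_ae [SFinite ν] {f g : A × B → X} {u : Lp (Lp X q ν) p μ} (h : IsRep f u)
    (hfg : f =ᵐ[μ.prod ν] g) : IsRep g u := by
  filter_upwards [h, Measure.ae_ae_of_ae_prod hfg] with a ha hb
  filter_upwards [ha, hb] with b h1 h2
  rw [h1, h2]

/-- Equality on almost every section yields equality almost everywhere on the product only when the
coincidence set is measurable up to a null set; this is arranged by passing to strongly measurable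
versions. -/
theorem ae_eq_prod_of_ae_ae_eq [SFinite μ] [SFinite ν] {f g : A × B → X}
    (hf : AEStronglyMeasurable f (μ.prod ν)) (hg : AEStronglyMeasurable g (μ.prod ν))
    (h : ∀ᵐ a ∂μ, ∀ᵐ b ∂ν, f (a, b) = g (a, b)) : f =ᵐ[μ.prod ν] g := by
  refine hf.ae_eq_mk.trans (EventuallyEq.trans ?_ hg.ae_eq_mk.symm)
  refine (Measure.ae_prod_mem_iff_ae_ae_mem
    (hf.stronglyMeasurable_mk.measurableSet_eq_fun hg.stronglyMeasurable_mk)).2 ?_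
  filter_upwards [h, Measure.ae_ae_of_ae_prod hf.ae_eq_mk,
    Measure.ae_ae_of_ae_prod hg.ae_eq_mk] with a h1 h2 h3
  filter_upwards [h1, h2, h3] with b h1 h2 h3
  rw [← h2, ← h3, h1]

theorem IsRep.ae_eq [SFinite μ] [SFinite ν] {f g : A × B → X} {u : Lp (Lp X q ν) p μ}
    (h : IsRep f u) (h' : IsRep g u)
    (hf : AEStronglyMeasurable f (μ.prod ν)) (hg : AEStronglyMeasurable g (μ.prod ν)) :
    f =ᵐ[μ.prod ν] g := by
  refine ae_eq_prod_of_ae_ae_eq hf hg ?_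
  filter_upwards [h, h'] with a h1 h2
  filter_upwards [h1, h2] with b h1 h2
  rw [← h1, h2]

theorem IsRep.eq {f : A × B → X} {u v : Lp (Lp X q ν) p μ} (h : IsRep f u) (h' : IsRep f v) :
    u = v := by
  refine Lp.ext ?_
  filter_upwards [h, h'] with a h1 h2
  refine Lp.ext ?_
  filter_upwards [h1, h2] with b h1 h2
  rw [h1, h2]

theorem IsRep.add {f g : A × B → X} {u v : Lp (Lp X q ν) p μ} (hu : IsRep f u)
    (hv : IsRep g v) : IsRep (f + g) (u + v) := by
  filter_upwards [Lp.coeFn_add u v, hu, hv] with a ha hua hva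
  rw [ha, Pi.add_apply]
  filter_upwards [Lp.coeFn_add (u a) (v a), hua, hva] with b hb hub hvb
  rw [hb, Pi.add_apply, hub, hvb, Pi.add_apply]

theorem IsRep.sub {f g : A × B → X} {u v : Lp (Lp X q ν) p μ} (hu : IsRep f u)
    (hv : IsRep g v) : IsRep (f - g) (u - v) := by
  filter_upwards [Lp.coeFn_sub u v, hu, hv] with a ha hua hva
  rw [ha, Pi.sub_apply]
  filter_upwards [Lp.coeFn_sub (u a) (v a), hua, hva] with b hb hub hvb
  rw [hb, Pi.sub_apply, hub, hvb, Pi.sub_apply]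

theorem IsRep.smul {𝕜 : Type*} [RCLike 𝕜] [NormedSpace 𝕜 X] [Fact (1 ≤ p)] (c : 𝕜)
    {f : A × B → X} {u : Lp (Lp X q ν) p μ} (hu : IsRep f u) : IsRep (c • f) (c • u) := by
  filter_upwards [Lp.coeFn_smul c u, hu] with a ha hua
  rw [ha, Pi.smul_apply]
  filter_upwards [Lp.coeFn_smul c (u a), hua] with b hb hub
  rw [hb, Pi.smul_apply, hub, Pi.smul_apply]

end IsRep

end Basic

/-! ### Elements of the mixed space versus jointly measurable functions. -/

section MeasurableSections

variable {A B X : Type*} [MeasurableSpace B]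

/-- The function `a ↦ f (a, ·)` with values in `L^q(ν; X)`; it has the value `0` where the section
is not in `L^q(ν; X)`. -/
noncomputable def sectionLp [NormedAddCommGroup X] (q : ℝ≥0∞) (ν : Measure B) (f : A × B → X)
    (a : A) : Lp X q ν :=
  open scoped Classical in
  if h : MemLp (fun b => f (a, b)) q ν then h.toLp _ else 0

theorem coeFn_sectionLp [NormedAddCommGroup X] {ν : Measure B} {q : ℝ≥0∞} {f : A × B → X}
    {a : A} (h : MemLp (fun b => f (a, b)) q ν) :
    sectionLp q ν f a =ᵐ[ν] fun b => f (a, b) := by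
  rw [sectionLp, dif_pos h]
  exact h.coeFn_toLp

section Sections

variable [MeasurableSpace A] [NormedAddCommGroup X] {μ : Measure A} {ν : Measure B} {p q : ℝ≥0∞}
  [Fact (1 ≤ q)]

/-- The sections of `f` are the values of a strongly measurable function with values in
`L^q(ν; X)`. -/
def HasMeasurableSections (q : ℝ≥0∞) [Fact (1 ≤ q)] (ν : Measure B) (f : A × B → X) : Prop :=
  ∃ U : A → Lp X q ν, StronglyMeasurable U ∧ ∀ a, U a =ᵐ[ν] fun b => f (a, b)

theorem HasMeasurableSections.add {f g : A × B → X} (hf : HasMeasurableSections q ν f)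
    (hg : HasMeasurableSections q ν g) : HasMeasurableSections q ν (f + g) := by
  obtain ⟨U, hU, hUf⟩ := hf
  obtain ⟨V, hV, hVg⟩ := hg
  refine ⟨U + V, hU.add hV, fun a => ?_⟩
  filter_upwards [Lp.coeFn_add (U a) (V a), hUf a, hVg a] with b h1 h2 h3
  rw [Pi.add_apply, h1, Pi.add_apply, h2, h3, Pi.add_apply]

theorem HasMeasurableSections.sub {f g : A × B → X} (hf : HasMeasurableSections q ν f)
    (hg : HasMeasurableSections q ν g) : HasMeasurableSections q ν (f - g) := by
  obtain ⟨U, hU, hUf⟩ := hf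
  obtain ⟨V, hV, hVg⟩ := hg
  refine ⟨U - V, hU.sub hV, fun a => ?_⟩
  filter_upwards [Lp.coeFn_sub (U a) (V a), hUf a, hVg a] with b h1 h2 h3
  rw [Pi.sub_apply, h1, Pi.sub_apply, h2, h3, Pi.sub_apply]

theorem tendsto_toLp_of_tendsto_eLpNorm {U : ℕ → Lp X q ν} {f : ℕ → B → X} {g : B → X}
    (hg : MemLp g q ν) (hU : ∀ n, U n =ᵐ[ν] f n)
    (h : Tendsto (fun n => eLpNorm (f n - g) q ν) atTop (𝓝 0)) :
    Tendsto U atTop (𝓝 (hg.toLp g)) := by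
  rw [Lp.tendsto_Lp_iff_tendsto_eLpNorm']
  refine h.congr fun n => eLpNorm_congr_ae ?_
  exact (hU n).symm.sub hg.coeFn_toLp.symm

theorem HasMeasurableSections.of_tendsto {f : ℕ → A × B → X} {g : A × B → X}
    (hf : ∀ n, HasMeasurableSections q ν (f n)) (hg : ∀ a, MemLp (fun b => g (a, b)) q ν)
    (h : ∀ a, Tendsto (fun n => eLpNorm ((fun b => f n (a, b)) - fun b => g (a, b)) q ν)
      atTop (𝓝 0)) : HasMeasurableSections q ν g := by
  choose U hU hUf using hf
  refine ⟨fun a => (hg a).toLp _, stronglyMeasurable_of_tendsto atTop hU ?_,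
    fun a => (hg a).coeFn_toLp⟩
  exact tendsto_pi_nhds.2 fun a =>
    tendsto_toLp_of_tendsto_eLpNorm (hg a) (fun n => hUf n a) (h a)

theorem isRep_indicatorConstLp {s : Set A} (hs : MeasurableSet s) (hμs : μ s ≠ ∞)
    {f : B → X} {c : Lp X q ν} (hf : c =ᵐ[ν] f) :
    IsRep ((s ×ˢ Set.univ).indicator fun z : A × B => f z.2) (indicatorConstLp p hs hμs c) := by
  filter_upwards [indicatorConstLp_coeFn (p := p) (hs := hs) (hμs := hμs) (c := c)] with a ha
  rw [ha]
  by_cases has : a ∈ s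
  · filter_upwards [hf] with b hb
    simp [has, hb]
  · filter_upwards [Lp.coeFn_zero X q ν] with b hb
    simpa [has] using hb

variable [IsFiniteMeasure ν]

theorem hasMeasurableSections_indicator_rectangle {s : Set A} {t : Set B} (hs : MeasurableSet s)
    (ht : MeasurableSet t) (c : X) :
    HasMeasurableSections q ν ((s ×ˢ t).indicator fun _ => c) := by
  refine ⟨s.indicator fun _ => indicatorConstLp q ht (measure_ne_top ν t) c,
    stronglyMeasurable_const.indicator hs, fun a => ?_⟩
  by_cases ha : a ∈ s
  · simp only [ha, Set.indicator_of_mem]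
    filter_upwards [indicatorConstLp_coeFn (p := q) (hs := ht) (hμs := measure_ne_top ν t)
      (c := c)] with b hb
    rw [hb]
    by_cases hb : b ∈ t <;> simp [ha, hb]
  · simp only [ha, not_false_eq_true, Set.indicator_of_notMem]
    filter_upwards [Lp.coeFn_zero X q ν] with b hb
    rw [hb]
    simp [ha]

/-- Dynkin's π-λ argument from measurable rectangles. Finiteness of `q` is what makes the indicators
of partial unions converge in `L^q(ν; X)`. -/
theorem hasMeasurableSections_indicator (hq : q ≠ ∞) (c : X) {S : Set (A × B)}
    (hS : MeasurableSet S) : HasMeasurableSections q ν (S.indicator fun _ => c) := by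
  induction S, hS using MeasurableSpace.induction_on_inter generateFrom_prod.symm isPiSystem_prod
  case empty =>
    simpa using hasMeasurableSections_indicator_rectangle (q := q) (ν := ν)
      (MeasurableSet.empty (α := A)) (MeasurableSet.empty (α := B)) c
  case basic t ht =>
    obtain ⟨s, hs, t, ht, rfl⟩ := ht
    exact hasMeasurableSections_indicator_rectangle hs ht c
  case compl t ht h =>
    rw [Set.indicator_compl]
    refine HasMeasurableSections.sub ?_ h
    simpa using hasMeasurableSections_indicator_rectangle (q := q) (ν := ν)
      (MeasurableSet.univ (α := A)) (MeasurableSet.univ (α := B)) c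
  case iUnion f hd hfm h =>
    have hsec : ∀ {S : Set (A × B)}, MeasurableSet S → ∀ a, MeasurableSet (Prod.mk a ⁻¹' S) :=
      fun hS a => measurable_prodMk_left hS
    have hfin : ∀ n, MeasurableSet (⋃ i ∈ Finset.range n, f i) := fun n =>
      Finset.measurableSet_biUnion _ fun i _ => hfm i
    have hU := MeasurableSet.iUnion hfm
    refine HasMeasurableSections.of_tendsto
      (f := fun n => (⋃ i ∈ Finset.range n, f i).indicator fun _ => c) (fun n => ?_) (fun a => ?_)
      fun a => ?_
    · induction n with
      | zero =>
        simpa using hasMeasurableSections_indicator_rectangle (q := q) (ν := ν)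
          (MeasurableSet.empty (α := A)) (MeasurableSet.empty (α := B)) c
      | succ n ih =>
        have : Disjoint (f n) (⋃ i ∈ Finset.range n, f i) := by
          simp only [Set.disjoint_iUnion_right, Finset.mem_range]
          exact fun i hi => hd hi.ne'
        rw [Finset.range_add_one, Finset.set_biUnion_insert,
          Set.indicator_union_of_disjoint this]
        exact (h n).add ih
    · exact memLp_indicator_const q (hsec hU a) c (Or.inr (measure_ne_top _ _))
    -- The missing parts of the section decrease to the empty set, so continuity from above applies.
    · have key : Tendsto (fun n => ν ((Prod.mk a ⁻¹' ⋃ i ∈ Finset.range n, f i) ∆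
          (Prod.mk a ⁻¹' ⋃ i, f i))) atTop (𝓝 0) := by
        have hsub : ∀ n, (Prod.mk a ⁻¹' ⋃ i ∈ Finset.range n, f i) ⊆ Prod.mk a ⁻¹' ⋃ i, f i :=
          fun n => Set.preimage_mono (Set.iUnion₂_subset fun i _ => Set.subset_iUnion f i)
        have hanti : Antitone fun n => (Prod.mk a ⁻¹' ⋃ i, f i) \
            (Prod.mk a ⁻¹' ⋃ i ∈ Finset.range n, f i) := fun m n hmn =>
          Set.sdiff_subset_sdiff_right (Set.preimage_mono
            (Set.biUnion_subset_biUnion_left (Finset.range_mono hmn)))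
        have hemp : ⋂ n, ((Prod.mk a ⁻¹' ⋃ i, f i) \
            (Prod.mk a ⁻¹' ⋃ i ∈ Finset.range n, f i)) = ∅ := by
          refine Set.eq_empty_of_forall_notMem fun b hb => ?_
          simp only [Set.mem_iInter, Set.mem_sdiff, Set.mem_preimage, Set.mem_iUnion,
            Finset.mem_range, not_exists] at hb
          obtain ⟨i, hi⟩ := (hb 0).1
          exact (hb (i + 1)).2 i (Nat.lt_succ_self i) hi
        have := tendsto_measure_iInter_atTop (μ := ν)
          (fun n => ((hsec hU a).diff (hsec (hfin n) a)).nullMeasurableSet) hanti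
          ⟨0, measure_ne_top _ _⟩
        rw [hemp, measure_empty] at this
        refine this.congr fun n => ?_
        rw [symmDiff_of_le (hsub n), Function.comp_apply]
      have := tendsto_indicatorConstLp_set (p := q) (c := c) (hs := hsec hU a)
        (hμs := measure_ne_top ν _) (ht := fun n => hsec (hfin n) a)
        (hμt := fun n => measure_ne_top ν _) hq key
      exact (Lp.tendsto_Lp_iff_tendsto_eLpNorm'' _ _ _ _).1 this

theorem hasMeasurableSections_simpleFunc (hq : q ≠ ∞) (f : SimpleFunc (A × B) X) :
    HasMeasurableSections q ν f := by
  induction f using SimpleFunc.induction with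
  | const c hs =>
    simp only [SimpleFunc.coe_piecewise, SimpleFunc.coe_const, Function.const_zero,
      Set.piecewise_eq_indicator]
    exact hasMeasurableSections_indicator (q := q) (ν := ν) hq c hs
  | add _ hf hg => exact hf.add hg

/-- The range of `f` is separable, so `f` is approximated by simple functions whose sections
converge in `L^q(ν; X)` at every `a` where the section of `f` lies in that space. -/
theorem aestronglyMeasurable_sectionLp (hq : q ≠ ∞) {f : A × B → X} (hf : StronglyMeasurable f)
    (h : ∀ᵐ a ∂μ, MemLp (fun b => f (a, b)) q ν) :
    AEStronglyMeasurable (sectionLp q ν f) μ := by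
  borelize X
  have : TopologicalSpace.SeparableSpace (Set.range f ∪ {0} : Set X) :=
    hf.separableSpace_range_union_singleton
  let s : ℕ → SimpleFunc (A × B) X := SimpleFunc.approxOn f hf.measurable (Set.range f ∪ {0}) 0
    (by simp)
  choose U hU hUs using fun n => hasMeasurableSections_simpleFunc (ν := ν) hq (s n)
  refine aestronglyMeasurable_of_tendsto_ae atTop (fun n => (hU n).aestronglyMeasurable) ?_
  filter_upwards [h] with a ha
  rw [sectionLp, dif_pos ha]
  refine tendsto_toLp_of_tendsto_eLpNorm ha (fun n => hUs n a) ?_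
  refine SimpleFunc.tendsto_approxOn_Lp_eLpNorm (hf.measurable.comp measurable_prodMk_left)
    (s := Set.range f ∪ {0}) (y₀ := 0) (by simp) hq ?_ (by simpa using ha.2)
  exact Eventually.of_forall fun b => subset_closure (by simp)

/-- A function on `A × B` of finite mixed norm represents an element of `L^p(μ; L^q(ν; X))`. -/
theorem exists_isRep_of_mixedNorm_lt_top [SFinite μ] [Fact (1 ≤ p)] (hp : p ≠ ∞) (hq : q ≠ ∞)
    {f : A × B → X}
    (hf : AEStronglyMeasurable f (μ.prod ν)) (h : mixedNorm p q μ ν f < ∞) :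
    ∃ u : Lp (Lp X q ν) p μ, IsRep f u := by
  -- For a strongly measurable function every section is measurable, so membership in `L^q` is a
  -- matter of finite norm only.
  suffices H : ∀ g : A × B → X, StronglyMeasurable g → mixedNorm p q μ ν g < ∞ →
      ∃ u : Lp (Lp X q ν) p μ, IsRep g u by
    obtain ⟨u, hu⟩ := H (hf.mk f) hf.stronglyMeasurable_mk (by
      rwa [← mixedNorm_congr_enorm_ae (f := f) (hf.ae_eq_mk.mono fun z hz => by rw [hz])])
    exact ⟨u, hu.congr_ae hf.ae_eq_mk.symm⟩
  intro g hg hN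
  have hp0 : p ≠ 0 := (zero_lt_one.trans_le Fact.out).ne'
  have hq0 : q ≠ 0 := (zero_lt_one.trans_le Fact.out).ne'
  have hmem : ∀ᵐ a ∂μ, MemLp (fun b => g (a, b)) q ν := by
    have hm := aemeasurable_eLpNorm_section (μ := μ) (ν := ν)
      hg.aestronglyMeasurable.enorm hq0 hq
    rw [mixedNorm, eLpNorm_lt_top_iff_lintegral_rpow_enorm_lt_top hp0 hp] at hN
    filter_upwards [ae_lt_top' (hm.enorm.pow_const _) hN.ne] with a ha
    refine ⟨(hg.comp_measurable measurable_prodMk_left).aestronglyMeasurable, ?_⟩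
    rw [enorm_eq_self, ENNReal.rpow_lt_top_iff_of_pos (ENNReal.toReal_pos hp0 hp)] at ha
    exact ha
  have hmeas := aestronglyMeasurable_sectionLp hq hg hmem
  have hLp : MemLp (sectionLp q ν g) p μ := by
    refine ⟨hmeas, lt_of_eq_of_lt (eLpNorm_congr_enorm_ae ?_) hN⟩
    filter_upwards [hmem] with a ha
    rw [Lp.enorm_def, enorm_eq_self]
    exact eLpNorm_congr_ae (coeFn_sectionLp ha)
  refine ⟨hLp.toLp _, ?_⟩
  filter_upwards [hmem, hLp.coeFn_toLp] with a ha hb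
  rw [hb]
  exact coeFn_sectionLp ha


/-- On probability spaces the mixed norm dominates the `L¹(μ × ν)` norm, so representatives of a
convergent sequence are Cauchy in `L¹`; their limit represents the limit. This is the closure step
in the density argument for `exists_integrable_isRep`. -/
theorem isClosed_setOf_exists_integrable_isRep [CompleteSpace X] [IsProbabilityMeasure μ]
    [IsProbabilityMeasure ν] [Fact (1 ≤ p)] :
    IsClosed {u : Lp (Lp X q ν) p μ | ∃ f, Integrable f (μ.prod ν) ∧ IsRep f u} := by
  refine IsSeqClosed.isClosed fun u v hu huv => ?_
  choose f hf hfu using hu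
  have hdist : ∀ m n, edist ((hf m).toL1 (f m)) ((hf n).toL1 (f n)) ≤ edist (u m) (u n) := by
    intro m n
    rw [Lp.edist_def, edist_eq_enorm_sub, ← ((hfu m).sub (hfu n)).mixedNorm_eq]
    rw [eLpNorm_congr_ae ((hf m).coeFn_toL1.sub (hf n).coeFn_toL1)]
    exact eLpNorm_one_le_mixedNorm ((hf m).sub (hf n)).1 Fact.out Fact.out
  have hC : CauchySeq fun n => (hf n).toL1 (f n) := by
    rw [EMetric.cauchySeq_iff]
    intro ε hε
    obtain ⟨N, hN⟩ := EMetric.cauchySeq_iff.1 huv.cauchySeq ε hε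
    exact ⟨N, fun m hm n hn => (hdist m n).trans_lt (hN m hm n hn)⟩
  obtain ⟨g, hg⟩ := cauchySeq_tendsto_of_complete hC
  refine ⟨g, L1.integrable_coeFn g, ?_⟩
  have hgm := (L1.integrable_coeFn g).1
  -- For almost every `a`, `G n a` bounds the `L¹(ν)` distance from `v a` to the section of `g`.
  -- Since `∫ G n` tends to 0, Fatou gives `liminf G n = 0` almost everywhere, and no subsequence
  -- has to be extracted.
  let G : ℕ → A → ℝ≥0∞ := fun n a => ‖(v - u n) a‖ₑ + ∫⁻ b, ‖(f n - g) (a, b)‖ₑ ∂ν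
  have hGm1 : ∀ n, AEMeasurable (fun a => ∫⁻ b, ‖(f n - g) (a, b)‖ₑ ∂ν) μ := fun n =>
    ((hf n).1.sub hgm).enorm.lintegral_prod_right'
  have hGm : ∀ n, AEMeasurable (G n) μ := fun n =>
    (Lp.aestronglyMeasurable _).enorm.add (hGm1 n)
  have hGint : ∀ n, ∫⁻ a, G n a ∂μ ≤ edist v (u n) + edist ((hf n).toL1 (f n)) g := by
    intro n
    rw [lintegral_add_right' _ (hGm1 n)]
    refine add_le_add ?_ ?_
    · rw [edist_eq_enorm_sub, Lp.enorm_def, ← eLpNorm_one_eq_lintegral_enorm]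
      exact eLpNorm_le_eLpNorm_of_exponent_le Fact.out (Lp.aestronglyMeasurable _)
    · rw [← lintegral_prod (fun z => ‖(f n - g) z‖ₑ) ((hf n).1.sub hgm).enorm, Lp.edist_def,
        ← eLpNorm_one_eq_lintegral_enorm]
      exact (eLpNorm_congr_ae ((hf n).coeFn_toL1.sub (EventuallyEq.refl _ _))).ge
  have hlim : Tendsto (fun n => edist v (u n) + edist ((hf n).toL1 (f n)) g) atTop (𝓝 0) := by
    have h1 : Tendsto (fun n => edist v (u n)) atTop (𝓝 0) := by
      simpa [edist_comm] using tendsto_iff_edist_tendsto_0.1 huv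
    simpa using h1.add (tendsto_iff_edist_tendsto_0.1 hg)
  have hlim' : Tendsto (fun n => ∫⁻ a, G n a ∂μ) atTop (𝓝 0) :=
    tendsto_of_tendsto_of_tendsto_of_le_of_le tendsto_const_nhds hlim (fun _ => zero_le) hGint
  have hzero : ∀ᵐ a ∂μ, liminf (fun n => G n a) atTop = 0 := by
    have h0 : ∫⁻ a, liminf (fun n => G n a) atTop ∂μ = 0 :=
      le_antisymm ((lintegral_liminf_le' hGm).trans_eq hlim'.liminf_eq) zero_le
    have hmeas : AEMeasurable (fun a => liminf (fun n => G n a) atTop) μ := by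
      simp_rw [liminf_eq_iSup_iInf_of_nat]
      exact AEMeasurable.iSup fun n => AEMeasurable.biInf _ (Set.to_countable _) fun i _ => hGm i
    exact (lintegral_eq_zero_iff' hmeas).1 h0
  have hsub : ∀ᵐ a ∂μ, ∀ n, (v - u n) a = v a - u n a :=
    ae_all_iff.2 fun n => Lp.coeFn_sub v (u n)
  filter_upwards [hzero, hsub, ae_all_iff.2 hfu, hgm.prodMk_left,
    ae_all_iff.2 fun n => (hf n).1.prodMk_left] with a h0 h1 h2 h3 h4
  have hle : ∀ n, eLpNorm (⇑(v a) - fun b => g (a, b)) 1 ν ≤ G n a := by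
    intro n
    have e : (⇑(v a) - fun b => g (a, b)) =ᵐ[ν]
        ⇑(v a - u n a) + ((fun b => f n (a, b)) - fun b => g (a, b)) := by
      filter_upwards [Lp.coeFn_sub (v a) (u n a), h2 n] with b hb1 hb2
      simp only [Pi.sub_apply, Pi.add_apply, hb1, hb2]
      abel
    rw [eLpNorm_congr_ae e]
    refine (eLpNorm_add_le (Lp.aestronglyMeasurable _) ((h4 n).sub h3) le_rfl).trans
      (add_le_add ?_ ?_)
    · rw [h1 n, Lp.enorm_def]
      exact eLpNorm_le_eLpNorm_of_exponent_le Fact.out (Lp.aestronglyMeasurable _)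
    · rw [eLpNorm_one_eq_lintegral_enorm]
      exact le_rfl
  have hz : eLpNorm (⇑(v a) - fun b => g (a, b)) 1 ν = 0 := by
    refine le_antisymm ?_ zero_le
    rw [← h0]
    exact le_liminf_of_le (by isBoundedDefault) (Eventually.of_forall hle)
  rw [eLpNorm_eq_zero_iff ((Lp.aestronglyMeasurable _).sub h3) one_ne_zero] at hz
  filter_upwards [hz] with b hb
  exact sub_eq_zero.1 hb

/-- Every element of `L^p(μ; L^q(ν; X))` has a jointly integrable representative. -/
theorem exists_integrable_isRep [CompleteSpace X] [IsProbabilityMeasure μ]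
    [IsProbabilityMeasure ν] [Fact (1 ≤ p)] (hp : p ≠ ∞) (u : Lp (Lp X q ν) p μ) :
    ∃ f, Integrable f (μ.prod ν) ∧ IsRep f u := by
  induction u using Lp.induction hp with
  | indicatorConst c hs hμs =>
    rw [Lp.simpleFunc.coe_indicatorConst]
    refine ⟨_, ?_, isRep_indicatorConstLp hs hμs.ne EventuallyEq.rfl⟩
    refine Integrable.indicator ?_ (hs.prod .univ)
    exact ((Lp.memLp c).integrable Fact.out).comp_snd μ
  | add hf hg _ hfu hgv =>
    obtain ⟨f, hf, hfu⟩ := hfu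
    obtain ⟨g, hg, hgv⟩ := hgv
    exact ⟨f + g, hf.add hg, hfu.add hgv⟩
  | isClosed => exact isClosed_setOf_exists_integrable_isRep

end Sections

end MeasurableSections

/-! ### The converse of Hölder's inequality for mixed norms. -/

section ConverseHolder

variable {A B : Type*} [MeasurableSpace A] [MeasurableSpace B] {μ : Measure A} {ν : Measure B}

theorem mixedNorm_eq_lintegral {p q : ℝ≥0∞} (hp0 : p ≠ 0) (hp : p ≠ ∞) (hq0 : q ≠ 0) (hq : q ≠ ∞)
    (f : A × B → ℝ≥0∞) : mixedNorm p q μ ν f =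
      (∫⁻ a, (∫⁻ b, f (a, b) ^ q.toReal ∂ν) ^ (p.toReal / q.toReal) ∂μ) ^ (1 / p.toReal) := by
  simp only [mixedNorm, eLpNorm_eq_lintegral_rpow_enorm_toReal hp0 hp,
    eLpNorm_eq_lintegral_rpow_enorm_toReal hq0 hq, enorm_eq_self, ← ENNReal.rpow_mul]
  simp only [one_div_mul_eq_div]

theorem iSup_min_natCast (x : ℝ≥0∞) : ⨆ n : ℕ, min x n = x := by
  have := inf_iSup_eq x (fun n : ℕ => (n : ℝ≥0∞))
  rw [ENNReal.iSup_natCast, inf_top_eq] at this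
  exact this.symm

theorem iSup_rpow {ι : Type*} (x : ι → ℝ≥0∞) {r : ℝ} (hr : 0 < r) :
    (⨆ i, x i) ^ r = ⨆ i, x i ^ r :=
  (ENNReal.orderIsoRpow r hr).map_iSup x

/-- Monotone convergence in both integrals. Truncation is needed because the extremal-function
argument divides by a power of the norm, which must be finite. -/
theorem mixedNorm_le_of_forall_min_le [SFinite ν] {p q : ℝ≥0∞} (hp0 : p ≠ 0) (hp : p ≠ ∞)
    (hq0 : q ≠ 0) (hq : q ≠ ∞) {h : A × B → ℝ≥0∞} (hh : Measurable h) {C : ℝ≥0∞}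
    (H : ∀ n : ℕ, mixedNorm p q μ ν (fun z => min (h z) n) ≤ C) : mixedNorm p q μ ν h ≤ C := by
  have hP : 0 < p.toReal := ENNReal.toReal_pos hp0 hp
  have hQ : 0 < q.toReal := ENNReal.toReal_pos hq0 hq
  have hm : ∀ n : ℕ, Measurable fun z => min (h z) (n : ℝ≥0∞) := fun n => by fun_prop
  have hmono : ∀ x : ℝ≥0∞, Monotone fun n : ℕ => min x (n : ℝ≥0∞) := fun x m n hmn =>
    min_le_min_left _ (by exact_mod_cast hmn)
  suffices mixedNorm p q μ ν h = ⨆ n : ℕ, mixedNorm p q μ ν (fun z => min (h z) n) by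
    rw [this]
    exact iSup_le H
  simp only [mixedNorm_eq_lintegral hp0 hp hq0 hq]
  rw [← iSup_rpow _ (by positivity), ← lintegral_iSup]
  · congr! 3 with a
    rw [← iSup_rpow _ (by positivity), ← lintegral_iSup]
    · congr! 3 with b
      rw [← iSup_rpow _ hQ, iSup_min_natCast]
    · exact fun n => ((hm n).comp measurable_prodMk_left).pow_const _
    · exact fun m n hmn b => ENNReal.rpow_le_rpow (hmono _ hmn) hQ.le
  · exact fun n => ((hm n).pow_const _).lintegral_prod_right'.pow_const _
  · exact fun m n hmn a => ENNReal.rpow_le_rpow (lintegral_mono fun b =>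
      ENNReal.rpow_le_rpow (hmono _ hmn) hQ.le) (by positivity)

theorem lintegral_mul_le_of_forall_bounded [SFinite ν] {p' q' C : ℝ≥0∞} {h f : A × B → ℝ≥0∞}
    (hh : Measurable h) (hf : Measurable f)
    (H : ∀ s : A × B → ℝ≥0, Measurable s → (∃ K, ∀ z, s z ≤ K) →
      ∫⁻ z, s z * h z ∂μ.prod ν ≤ C * mixedNorm p' q' μ ν fun z => (s z : ℝ)) :
    ∫⁻ z, f z * h z ∂μ.prod ν ≤ C * mixedNorm p' q' μ ν f := by
  have hm : ∀ n : ℕ, Measurable fun z => min (f z) (n : ℝ≥0∞) := fun n => by fun_prop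
  have hn : ∀ (n : ℕ) z, ((min (f z) (n : ℝ≥0∞)).toNNReal : ℝ≥0∞) = min (f z) n := fun n z =>
    ENNReal.coe_toNNReal (ne_top_of_le_ne_top (ENNReal.natCast_ne_top n) (min_le_right _ _))
  have key : ∀ n : ℕ, ∫⁻ z, min (f z) n * h z ∂μ.prod ν ≤ C * mixedNorm p' q' μ ν f := by
    intro n
    have := H (fun z => (min (f z) (n : ℝ≥0∞)).toNNReal) (hm n).ennreal_toNNReal
      ⟨n, fun z => by
        rw [← ENNReal.coe_le_coe, hn]
        simp⟩
    simp only [hn] at this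
    refine this.trans (mul_le_mul_right (mixedNorm_mono_ae (Eventually.of_forall fun z => ?_)) _)
    rw [NNReal.enorm_eq, hn]
    simp
  have : ∀ z, f z * h z = ⨆ n : ℕ, min (f z) n * h z := fun z => by
    rw [← ENNReal.iSup_mul, iSup_min_natCast]
  simp only [this]
  rw [lintegral_iSup (f := fun (n : ℕ) z => min (f z) n * h z) (fun n => (hm n).mul hh)]
  · exact iSup_le key
  · exact fun m n hmn z => by dsimp only; gcongr

theorem rpow_one_div_le_of_le_mul_rpow {J C : ℝ≥0∞} {P P' : ℝ} (hP : P.HolderConjugate P')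
    (hJ : J ≠ ∞) (h : J ≤ C * J ^ (1 / P')) : J ^ (1 / P) ≤ C := by
  rcases eq_or_ne J 0 with rfl | hJ0
  · simp [hP.pos]
  have h1 : J ^ (1 / P) * J ^ (1 / P') = J := by
    rw [← ENNReal.rpow_add _ _ hJ0 hJ, one_div, one_div, hP.inv_add_inv_eq_one, ENNReal.rpow_one]
  have h2 : J ^ (1 / P') ≠ 0 := by simp [hJ0, hJ]
  have h3 : J ^ (1 / P') ≠ ∞ := ENNReal.rpow_ne_top_of_nonneg (by simp [hP.symm.nonneg]) hJ
  rw [← ENNReal.mul_le_mul_iff_left h2 h3, h1]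
  exact h

/-- The converse of Hölder's inequality for mixed norms, for bounded functions. -/
theorem mixedNorm_le_of_bounded [IsProbabilityMeasure μ] [IsProbabilityMeasure ν]
    (p q p' q' : ℝ≥0∞) [p.HolderConjugate p'] [q.HolderConjugate q'] (hp : 1 < p) (hp_top : p < ∞)
    (hq : 1 < q) (hq_top : q < ∞) {g : A × B → ℝ≥0∞} (hg : Measurable g) {n : ℕ}
    (hgn : ∀ z, g z ≤ n) {C : ℝ≥0∞}
    (H : ∀ f : A × B → ℝ≥0∞, Measurable f →
      ∫⁻ z, f z * g z ∂μ.prod ν ≤ C * mixedNorm p' q' μ ν f) :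
    mixedNorm p q μ ν g ≤ C := by
  have hsp : p'.HolderConjugate p := .symm
  have hsq : q'.HolderConjugate q := .symm
  have hp'_top : p' < ∞ := (ENNReal.HolderConjugate.lt_top_iff_one_lt p' p).2 hp
  have hq'_top : q' < ∞ := (ENNReal.HolderConjugate.lt_top_iff_one_lt q' q).2 hq
  have hP := ENNReal.HolderConjugate.toReal_of_ne_top hp_top.ne hp'_top.ne
  have hQ := ENNReal.HolderConjugate.toReal_of_ne_top hq_top.ne hq'_top.ne
  have hp'0 : p' ≠ 0 := ENNReal.HolderConjugate.ne_zero p' p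
  have hq'0 : q' ≠ 0 := ENNReal.HolderConjugate.ne_zero q' q
  have hp0 : p ≠ 0 := ENNReal.HolderConjugate.ne_zero p p'
  have hq0 : q ≠ 0 := ENNReal.HolderConjugate.ne_zero q q'
  have HN := mixedNorm_eq_lintegral (μ := μ) (ν := ν) hp0 hp_top.ne hq0 hq_top.ne g
  have HN' := fun f => mixedNorm_eq_lintegral (μ := μ) (ν := ν) hp'0 hp'_top.ne hq'0 hq'_top.ne f
  generalize p.toReal = P at *
  generalize p'.toReal = P' at *
  generalize q.toReal = Q at *
  generalize q'.toReal = Q' at *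
  have hP0 := hP.pos
  have hP'0 := hP.symm.pos
  have hQ0 := hQ.pos
  have hQ'0 := hQ.symm.pos
  have hQ1 : 0 < Q - 1 := hQ.sub_one_pos
  let I : A → ℝ≥0∞ := fun a => ∫⁻ b, g (a, b) ^ Q ∂ν
  have hI : Measurable I := (hg.pow_const Q).lintegral_prod_right'
  have hIle : ∀ a, I a ≤ (n : ℝ≥0∞) ^ Q := fun a => by
    refine (lintegral_mono fun b => ENNReal.rpow_le_rpow (hgn (a, b)) hQ0.le).trans ?_
    simp
  have hItop : ∀ a, I a ≠ ∞ := fun a =>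
    ne_top_of_le_ne_top (ENNReal.rpow_ne_top_of_nonneg hQ0.le (ENNReal.natCast_ne_top n)) (hIle a)
  let J : ℝ≥0∞ := ∫⁻ a, I a ^ (P / Q) ∂μ
  have hJ : J ≠ ∞ := by
    have hle : J ≤ ((n : ℝ≥0∞) ^ Q) ^ (P / Q) := by
      refine (lintegral_mono fun a => ENNReal.rpow_le_rpow (hIle a) (by positivity)).trans ?_
      simp
    exact ne_top_of_le_ne_top (ENNReal.rpow_ne_top_of_nonneg (by positivity)
      (ENNReal.rpow_ne_top_of_nonneg hQ0.le (ENNReal.natCast_ne_top n))) hle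
  -- The extremal function for the mixed norm is `f = I(a)^(P/Q - 1) g^(Q - 1)`: it gives `∫ f g =
  -- J` and `‖f‖ = J^(1/P')`. The exponent `P/Q - 1` may be negative, hence the separate value where
  -- `I a = 0`.
  let w : A → ℝ≥0∞ := fun a => if I a = 0 then 0 else I a ^ (P / Q - 1)
  have hw : Measurable w := Measurable.ite (hI (measurableSet_singleton 0)) measurable_const
    (hI.pow_const _)
  let f : A × B → ℝ≥0∞ := fun z => w z.1 * g z ^ (Q - 1)
  have hf : Measurable f := (hw.comp measurable_fst).mul (hg.pow_const _)
  have hga : ∀ a, Measurable fun b => g (a, b) := fun a => hg.comp measurable_prodMk_left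
  have hfg : ∫⁻ z, f z * g z ∂μ.prod ν = J := by
    rw [lintegral_prod (fun z => f z * g z) (hf.mul hg).aemeasurable]
    refine lintegral_congr fun a => ?_
    have : ∀ b, f (a, b) * g (a, b) = w a * g (a, b) ^ Q := fun b => by
      have : g (a, b) ^ (Q - 1) * g (a, b) = g (a, b) ^ Q := by
        conv_lhs => rw [← ENNReal.rpow_one (g (a, b)), ← ENNReal.rpow_mul, one_mul,
          ← ENNReal.rpow_add_of_nonneg _ _ hQ1.le zero_le_one, sub_add_cancel]
      rw [← this, ← mul_assoc]
    simp only [this]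
    rw [lintegral_const_mul _ ((hga a).pow_const Q)]
    change w a * I a = _
    by_cases h0 : I a = 0
    · simp [w, h0, div_pos hP0 hQ0]
    · simp only [w, h0, if_false]
      conv_lhs => rw [← ENNReal.rpow_one (I a), ← ENNReal.rpow_mul, one_mul,
        ← ENNReal.rpow_add _ _ h0 (hItop a), sub_add_cancel]
  have hNf : mixedNorm p' q' μ ν f = J ^ (1 / P') := by
    rw [HN']
    congr 1
    refine lintegral_congr fun a => ?_
    have : ∀ b, f (a, b) ^ Q' = w a ^ Q' * g (a, b) ^ Q := fun b => by
      rw [ENNReal.mul_rpow_of_nonneg _ _ hQ'0.le, ← ENNReal.rpow_mul, hQ.sub_one_mul_conj]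
    simp only [this]
    rw [lintegral_const_mul _ ((hga a).pow_const Q)]
    change (w a ^ Q' * I a) ^ _ = _
    by_cases h0 : I a = 0
    · simp [w, h0, div_pos hP0 hQ0, div_pos hP'0 hQ'0]
    · simp only [w, h0, if_false]
      conv_lhs => rw [← ENNReal.rpow_one (I a), ← ENNReal.rpow_mul, ← ENNReal.rpow_mul, one_mul,
        ← ENNReal.rpow_add _ _ h0 (hItop a), ← ENNReal.rpow_mul]
      -- The identity of exponents is `((P/Q - 1) Q' + 1) (P'/Q') = P/Q`.
      congr 1
      have e1 : P' = P / (P - 1) := hP.conjugate_eq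
      have e2 : Q' = Q / (Q - 1) := hQ.conjugate_eq
      have hP1 := hP.sub_one_pos.ne'
      have hQ1' := hQ1.ne'
      rw [e1, e2]
      field_simp
      ring
  rw [HN]
  refine rpow_one_div_le_of_le_mul_rpow hP hJ ?_
  have := H f hf
  rwa [hfg, hNf] at this

/-- The converse of Hölder's inequality for mixed norms. -/
theorem mixedNorm_le_of_forall_lintegral_mul_le [IsProbabilityMeasure μ] [IsProbabilityMeasure ν]
    (p q p' q' : ℝ≥0∞) [p.HolderConjugate p'] [q.HolderConjugate q'] (hp : 1 < p) (hp_top : p < ∞)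
    (hq : 1 < q) (hq_top : q < ∞) {h : A × B → ℝ≥0∞} (hh : AEMeasurable h (μ.prod ν)) {C : ℝ≥0∞}
    (H : ∀ s : A × B → ℝ≥0, Measurable s → (∃ K, ∀ z, s z ≤ K) →
      ∫⁻ z, s z * h z ∂μ.prod ν ≤ C * mixedNorm p' q' μ ν fun z => (s z : ℝ)) :
    mixedNorm p q μ ν h ≤ C := by
  wlog hm : Measurable h generalizing h
  · rw [mixedNorm_congr_enorm_ae (hh.ae_eq_mk.mono fun z hz => congrArg enorm hz)]
    refine this hh.measurable_mk.aemeasurable (fun s hs hK => ?_) hh.measurable_mk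
    refine (lintegral_congr_ae ?_).trans_le (H s hs hK)
    filter_upwards [hh.ae_eq_mk] with z hz
    rw [hz]
  refine mixedNorm_le_of_forall_min_le (zero_lt_one.trans hp).ne' hp_top.ne
    (zero_lt_one.trans hq).ne' hq_top.ne hm fun n => ?_
  refine mixedNorm_le_of_bounded p q p' q' hp hp_top hq hq_top (hm.min measurable_const)
    (fun z => min_le_right _ _) fun f hf => ?_
  refine (lintegral_mono fun z => mul_le_mul_right (min_le_left _ _) _).trans
    (lintegral_mul_le_of_forall_bounded hm hf H)

end ConverseHolder

/-! ### Conditional expectation in mixed norms: passing to the conjugate exponents and changing `X`.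
-/

section CondExp

variable {A B : Type*} [MeasurableSpace A] [MeasurableSpace B] {F : MeasurableSpace (A × B)}
  {μ : Measure A} {ν : Measure B}

theorem integral_condExp_mul_eq {Ω 𝕜 : Type*} [RCLike 𝕜] {m m0 : MeasurableSpace Ω}
    {P : Measure Ω} [IsFiniteMeasure P] (hm : m ≤ m0) {f g : Ω → 𝕜} (hg : StronglyMeasurable[m] g)
    (hf : Integrable f P) (hfg : Integrable (fun x => f x * g x) P) :
    ∫ x, (P[f | m]) x * g x ∂P = ∫ x, f x * g x ∂P := by
  have h := condExp_bilin_of_stronglyMeasurable_right (ContinuousLinearMap.mul ℝ 𝕜) hg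
    (by simpa using hfg) hf
  simp only [ContinuousLinearMap.mul_apply'] at h
  rw [← integral_congr_ae h, integral_condExp hm]

/-- The conditional expectation is symmetric. -/
theorem integral_mul_condExp_eq {Ω : Type*} {m m0 : MeasurableSpace Ω}
    {P : Measure Ω} [IsFiniteMeasure P] (hm : m ≤ m0) {s f : Ω → ℝ}
    (hs : AEStronglyMeasurable s P) {K : ℝ≥0} (hK : ∀ x, |s x| ≤ K) (hf : Integrable f P) :
    ∫ x, s x * (P[f | m]) x ∂P = ∫ x, (P[s | m]) x * f x ∂P := by
  have hsi : Integrable s P := .of_bound hs K (.of_forall hK)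
  have hE : ∀ᵐ x ∂P, |(P[s | m]) x| ≤ K := ae_bdd_abs_condExp_of_ae_bdd_abs (.of_forall hK)
  -- Both sides equal `∫ E[s] E[f]`.
  rw [← integral_condExp_mul_eq hm stronglyMeasurable_condExp hsi
    (integrable_condExp.bdd_mul hs (.of_forall hK))]
  simp_rw [mul_comm ((P[s | m]) _)]
  rw [← integral_condExp_mul_eq hm stronglyMeasurable_condExp hf]
  exact hf.mul_bdd (c := K) integrable_condExp.1 hE

theorem eLpNorm_mul_const_ennreal {α : Type*} [MeasurableSpace α] {m : Measure α} {p c : ℝ≥0∞}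
    (hp0 : p ≠ 0) (hp : p ≠ ∞) (hc : c ≠ ∞) (f : α → ℝ≥0∞) :
    eLpNorm (fun x => f x * c) p m = eLpNorm f p m * c := by
  have hP := ENNReal.toReal_pos hp0 hp
  simp only [eLpNorm_eq_lintegral_rpow_enorm_toReal hp0 hp, enorm_eq_self,
    ENNReal.mul_rpow_of_nonneg _ _ hP.le]
  rw [lintegral_mul_const' _ _ (ENNReal.rpow_ne_top_of_nonneg hP.le hc),
    ENNReal.mul_rpow_of_nonneg _ _ (by positivity), ← ENNReal.rpow_mul, mul_one_div_cancel hP.ne',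
    ENNReal.rpow_one]

/-- The conditional expectation is bounded for the mixed norm, on bounded non-negative
functions. -/
def CondExpMixedBound (F : MeasurableSpace (A × B)) (μ : Measure A) (ν : Measure B)
    (p q : ℝ≥0∞) : Prop :=
  ∃ C : ℝ≥0, ∀ s : A × B → ℝ≥0, Measurable[Prod.instMeasurableSpace] s → (∃ K, ∀ z, s z ≤ K) →
    mixedNorm p q μ ν ((μ.prod ν)[fun z => (s z : ℝ) | F]) ≤
      C * mixedNorm p q μ ν (fun z => (s z : ℝ))

variable [IsProbabilityMeasure μ] [IsProbabilityMeasure ν]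
  {X : Type*} [NormedAddCommGroup X] [NormedSpace ℝ X] [CompleteSpace X]

/-- Duality exchanges the exponents, and `‖E f‖ ≤ E ‖f‖` removes `X`: a bound on bounded
non-negative scalar functions for `p', q'` suffices for all `X`-valued functions for `p, q`. -/
theorem mixedNorm_condExp_le_of_conjugate (hF : F ≤ Prod.instMeasurableSpace)
    (p q p' q' : ℝ≥0∞) [p.HolderConjugate p'] [q.HolderConjugate q'] (hp : 1 < p) (hp_top : p < ∞)
    (hq : 1 < q) (hq_top : q < ∞) (h : CondExpMixedBound F μ ν p' q') :
    ∃ C : ℝ≥0, ∀ f : A × B → X, Integrable f (μ.prod ν) →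
      mixedNorm p q μ ν ((μ.prod ν)[f | F]) ≤ C * mixedNorm p q μ ν f := by
  obtain ⟨C, hC⟩ := h
  refine ⟨C, fun f hf => ?_⟩
  rw [← mixedNorm_enorm]
  refine mixedNorm_le_of_forall_lintegral_mul_le p q p' q' hp hp_top hq hq_top
    integrable_condExp.1.enorm fun s hs ⟨K, hK⟩ => ?_
  have hK' : ∀ z, |(s z : ℝ)| ≤ K := fun z => by simpa using hK z
  have hsm : AEStronglyMeasurable[Prod.instMeasurableSpace] (fun z => (s z : ℝ)) (μ.prod ν) :=
    hs.coe_nnreal_real.aestronglyMeasurable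
  have hE0 : 0 ≤ᵐ[μ.prod ν] (μ.prod ν)[fun z => (s z : ℝ) | F] :=
    condExp_nonneg (.of_forall fun z => (s z).2)
  have hE1 : 0 ≤ᵐ[μ.prod ν] (μ.prod ν)[fun z => ‖f z‖ | F] :=
    condExp_nonneg (.of_forall fun z => norm_nonneg _)
  have hb : ∀ᵐ z ∂μ.prod ν, |((μ.prod ν)[fun z => (s z : ℝ) | F]) z| ≤ K :=
    ae_bdd_abs_condExp_of_ae_bdd_abs (.of_forall hK')
  calc ∫⁻ z, s z * ‖((μ.prod ν)[f | F]) z‖ₑ ∂μ.prod ν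
      ≤ ∫⁻ z, ENNReal.ofReal (s z * ((μ.prod ν)[fun z => ‖f z‖ | F]) z) ∂μ.prod ν := by
        refine lintegral_mono_ae ?_
        filter_upwards [norm_condExp_le (m := F) (μ := μ.prod ν) f] with z hz
        rw [ENNReal.ofReal_mul (s z).coe_nonneg, ENNReal.ofReal_coe_nnreal, ← ofReal_norm]
        gcongr
    _ = ENNReal.ofReal (∫ z, s z * ((μ.prod ν)[fun z => ‖f z‖ | F]) z ∂μ.prod ν) := by
        refine (ofReal_integral_eq_lintegral_ofReal
          (integrable_condExp.bdd_mul hsm (.of_forall hK')) ?_).symm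
        filter_upwards [hE1] with z hz
        exact mul_nonneg (s z).2 hz
    _ = ENNReal.ofReal (∫ z, ((μ.prod ν)[fun z => (s z : ℝ) | F]) z * ‖f z‖ ∂μ.prod ν) := by
        rw [integral_mul_condExp_eq hF hsm hK' hf.norm]
    _ = ∫⁻ z, ENNReal.ofReal (((μ.prod ν)[fun z => (s z : ℝ) | F]) z * ‖f z‖) ∂μ.prod ν := by
        refine ofReal_integral_eq_lintegral_ofReal
          (hf.norm.bdd_mul integrable_condExp.1 hb) ?_
        filter_upwards [hE0] with z hz
        exact mul_nonneg hz (norm_nonneg _)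
    _ = ∫⁻ z, ‖f z‖ₑ * ‖((μ.prod ν)[fun z => (s z : ℝ) | F]) z‖ₑ ∂μ.prod ν := by
        refine lintegral_congr_ae ?_
        filter_upwards [hE0] with z hz
        rw [ENNReal.ofReal_mul hz, mul_comm, ofReal_norm, Real.enorm_of_nonneg hz]
    _ ≤ mixedNorm p q μ ν (fun z => ‖f z‖ₑ) *
          mixedNorm p' q' μ ν fun z => ‖((μ.prod ν)[fun z => (s z : ℝ) | F]) z‖ₑ :=
        lintegral_mul_le_mixedNorm_mul_mixedNorm p q p' q' hp hp_top hq hq_top hf.1.enorm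
          integrable_condExp.1.enorm
    _ ≤ mixedNorm p q μ ν f * (C * mixedNorm p' q' μ ν fun z => (s z : ℝ)) := by
        rw [mixedNorm_enorm, mixedNorm_enorm]
        gcongr
        exact hC s hs ⟨K, hK⟩
    _ = C * mixedNorm p q μ ν f * mixedNorm p' q' μ ν fun z => (s z : ℝ) := by ring

variable {𝕜 : Type*} [RCLike 𝕜] [NormedSpace 𝕜 X] {p q : ℝ≥0∞} [Fact (1 ≤ p)] [Fact (1 ≤ q)]

/-- Jointly measurable representatives of one element agree `μ × ν`-almost everywhere, so any of
them may be used in place of the one supplied by the definition. -/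
theorem CondExpRestrictsToProjection.exists_isRep
    (h : CondExpRestrictsToProjection 𝕜 F μ ν X p q) :
    ∃ P : Lp (Lp X q ν) p μ →L[𝕜] Lp (Lp X q ν) p μ, ∀ u f, Integrable f (μ.prod ν) →
      IsRep f u → IsRep ((μ.prod ν)[f | F]) (P u) := by
  obtain ⟨P, -, hP⟩ := h
  refine ⟨P, fun u f hf hfu => ?_⟩
  obtain ⟨g, hg, hgu, hPu⟩ := hP u
  exact hPu.congr_ae (condExp_congr_ae (hgu.ae_eq hfu hg.1 hf.1))

/-- Fix `x ≠ 0`. The map `t ↦ t • x` commutes with `E` and multiplies mixed norms by `‖x‖`, which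
cancels. -/
theorem CondExpRestrictsToProjection.condExpMixedBound [Nontrivial X]
    (hp : p ≠ ∞) (hq : q ≠ ∞) (h : CondExpRestrictsToProjection 𝕜 F μ ν X p q) :
    CondExpMixedBound F μ ν p q := by
  obtain ⟨P, hP⟩ := h.exists_isRep
  obtain ⟨x, hx⟩ := exists_ne (0 : X)
  have hx0 : ‖x‖ₑ ≠ 0 := by simpa using hx
  refine ⟨‖P‖₊, fun s hs ⟨K, hK⟩ => ?_⟩
  let T : ℝ →L[ℝ] X := ContinuousLinearMap.toSpanSingleton ℝ x
  have hTN : ∀ g : A × B → ℝ, mixedNorm p q μ ν (T ∘ g) = mixedNorm p q μ ν g * ‖x‖ₑ := by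
    intro g
    have h1 : ∀ a, eLpNorm (fun b => (T ∘ g) (a, b)) q ν =
        eLpNorm (fun b => g (a, b)) q ν * ‖x‖ₑ := by
      intro a
      rw [mul_comm, ← enorm_norm x, ← eLpNorm_const_smul]
      exact eLpNorm_congr_norm_ae (.of_forall fun b => by simp [T, norm_smul, mul_comm])
    simp only [mixedNorm, h1]
    exact eLpNorm_mul_const_ennreal (zero_lt_one.trans_le Fact.out).ne' hp (by simp) _
  have hsm : AEStronglyMeasurable[Prod.instMeasurableSpace] (fun z => (s z : ℝ)) (μ.prod ν) :=
    hs.coe_nnreal_real.aestronglyMeasurable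
  have hsi : Integrable (fun z => (s z : ℝ)) (μ.prod ν) :=
    .of_bound hsm K (.of_forall fun z => by simpa using hK z)
  have hTs : Integrable (T ∘ fun z => (s z : ℝ)) (μ.prod ν) := T.integrable_comp hsi
  obtain ⟨u, hu⟩ := exists_isRep_of_mixedNorm_lt_top hp hq hTs.1 (by
    rw [hTN]
    exact ENNReal.mul_lt_top
      (mixedNorm_lt_top_of_bound (C := K) (.of_forall fun z => by simpa using hK z)) (by simp))
  have hPu := (hP u _ hTs hu).congr_ae (T.comp_condExp_comm hsi).symm
  have hle : ‖P u‖ₑ ≤ ‖P‖₊ * ‖u‖ₑ := P.le_opENorm u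
  rw [← hPu.mixedNorm_eq, ← hu.mixedNorm_eq, hTN, hTN, ← mul_assoc] at hle
  exact (ENNReal.mul_le_mul_iff_left hx0 (by simp)).1 hle

theorem condExpRestrictsToProjection_of_mixedNorm_le [IsScalarTower ℝ 𝕜 X]
    (hF : F ≤ Prod.instMeasurableSpace)
    (hp : p ≠ ∞) (hq : q ≠ ∞) {C : ℝ≥0} (hC : ∀ f : A × B → X, Integrable f (μ.prod ν) →
      mixedNorm p q μ ν ((μ.prod ν)[f | F]) ≤ C * mixedNorm p q μ ν f) :
    CondExpRestrictsToProjection 𝕜 F μ ν X p q := by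
  choose r hr hru using fun u : Lp (Lp X q ν) p μ => exists_integrable_isRep hp u
  have hfin : ∀ u, mixedNorm p q μ ν ((μ.prod ν)[r u | F]) < ∞ := fun u => by
    refine (hC _ (hr u)).trans_lt ?_
    rw [(hru u).mixedNorm_eq]
    exact ENNReal.mul_lt_top ENNReal.coe_lt_top (by simp)
  choose P hP using fun u => exists_isRep_of_mixedNorm_lt_top hp hq
    (integrable_condExp (f := r u)).1 (hfin u)
  -- Independence of the chosen representative; linearity and idempotence of `P` reduce to those of
  -- `E` through it.
  have hP' : ∀ u f, Integrable f (μ.prod ν) → IsRep f u → IsRep ((μ.prod ν)[f | F]) (P u) :=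
    fun u f hf hfu => (hP u).congr_ae (condExp_congr_ae ((hru u).ae_eq hfu (hr u).1 hf.1))
  let L : Lp (Lp X q ν) p μ →ₗ[𝕜] Lp (Lp X q ν) p μ :=
    { toFun := P
      map_add' := fun u v => by
        refine (hP' _ _ ((hr u).add (hr v)) ((hru u).add (hru v))).eq ?_
        exact ((hP u).add (hP v)).congr_ae (condExp_add (hr u) (hr v) F).symm
      map_smul' := fun c u => by
        refine (hP' _ _ ((hr u).smul c) ((hru u).smul c)).eq ?_
        exact ((hP u).smul c).congr_ae (condExp_smul c (r u) F).symm }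
  have hL : ∀ u, ‖L u‖ ≤ C * ‖u‖ := fun u => by
    have := hC _ (hr u)
    rw [(hP u).mixedNorm_eq, (hru u).mixedNorm_eq] at this
    rw [enorm_eq_nnnorm, enorm_eq_nnnorm] at this
    exact_mod_cast this
  refine ⟨L.mkContinuous C hL, ?_, fun u => ⟨r u, hr u, hru u, hP u⟩⟩
  ext1 u
  refine (hP' _ _ integrable_condExp (hP u)).eq ?_
  exact (hP u).congr_ae (condExp_condExp_of_le le_rfl hF).symm

theorem condExpRestrictsToProjection_of_conjugate [IsScalarTower ℝ 𝕜 X]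
    (hF : F ≤ Prod.instMeasurableSpace)
    (p' q' : ℝ≥0∞) [p.HolderConjugate p'] [q.HolderConjugate q'] (hp : 1 < p) (hp_top : p < ∞)
    (hq : 1 < q) (hq_top : q < ∞) (h : CondExpMixedBound F μ ν p' q') :
    CondExpRestrictsToProjection 𝕜 F μ ν X p q := by
  obtain ⟨C, hC⟩ := mixedNorm_condExp_le_of_conjugate (X := X) hF p q p' q' hp hp_top hq hq_top h
  exact condExpRestrictsToProjection_of_mixedNorm_le hF hp_top.ne hq_top.ne hC

end CondExp

/-! ### Abstract duality: restricting a pairing to subspaces. -/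

theorem exists_preimage_norm_le_of_isInvertible {𝕜 E G : Type*} [RCLike 𝕜]
    [NormedAddCommGroup E] [NormedSpace 𝕜 E] [NormedAddCommGroup G] [NormedSpace 𝕜 G]
    {T : E →L[𝕜] G} (h : T.IsInvertible) : ∃ D : ℝ≥0, ∀ y, ∃ x, T x = y ∧ ‖x‖ ≤ D * ‖y‖ := by
  obtain ⟨e, rfl⟩ := h
  exact ⟨‖(e.symm : G →L[𝕜] E)‖₊, fun y => ⟨e.symm y, e.apply_symm_apply y,
    (e.symm : G →L[𝕜] E).le_opNorm y⟩⟩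

theorem isInvertible_of_surjective_of_norm_le {𝕜 E G : Type*} [RCLike 𝕜]
    [NormedAddCommGroup E] [NormedSpace 𝕜 E] [NormedAddCommGroup G] [NormedSpace 𝕜 G]
    {T : E →L[𝕜] G} (hT : Function.Surjective T) {D : ℝ} (hD : ∀ x, ‖x‖ ≤ D * ‖T x‖) :
    T.IsInvertible := by
  have hinj : Function.Injective T := (injective_iff_map_eq_zero T).2 fun x hx => by
    simpa [hx] using hD x
  let e := LinearEquiv.ofBijective (T : E →ₗ[𝕜] G) ⟨hinj, hT⟩
  refine ⟨e.toContinuousLinearEquivOfBounds ‖T‖ D T.le_opNorm fun y => ?_, by ext; rfl⟩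
  have : T (e.symm y) = y := e.apply_symm_apply y
  conv_rhs => rw [← this]
  exact hD _

section RestrictedPairing

variable {𝕜 E G : Type*} [RCLike 𝕜] [NormedAddCommGroup E] [NormedSpace 𝕜 E]
  [NormedAddCommGroup G] [NormedSpace 𝕜 G] {M : E →L[𝕜] G →L[𝕜] 𝕜} {S : Submodule 𝕜 E}
  {R : Submodule 𝕜 G}

/-- `w` is the preimage of the functional `M u` restricted to `R`. In the application it turns out
to be the conditional expectation of `u`. -/
theorem exists_mem_of_isInvertible_bilinearComp
    (h : (M.bilinearComp S.subtypeL R.subtypeL).IsInvertible) :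
    ∃ D : ℝ≥0, ∀ u, ∃ w ∈ S, ‖w‖ ≤ D * ‖u‖ ∧ ∀ v ∈ R, M w v = M u v := by
  obtain ⟨D, hD⟩ := exists_preimage_norm_le_of_isInvertible h
  refine ⟨D * ‖M‖₊, fun u => ?_⟩
  obtain ⟨w, hw, hwn⟩ := hD ((M u).comp R.subtypeL)
  refine ⟨w, w.2, ?_, fun v hv => congrArg (fun Φ => Φ ⟨v, hv⟩) hw⟩
  have : ‖(M u).comp R.subtypeL‖ ≤ ‖M‖ * ‖u‖ :=
    ContinuousLinearMap.opNorm_le_bound _ (by positivity) fun v => M.le_opNorm₂ u v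
  calc ‖(w : E)‖ ≤ D * ‖(M u).comp R.subtypeL‖ := hwn
    _ ≤ D * (‖M‖ * ‖u‖) := by gcongr
    _ = _ := by push_cast; ring

/-- If `M` identifies `E` with the dual of `G`, and mutually adjoint projections onto `S` and `R`
exist, then `M` identifies `S` with the dual of `R`. -/
theorem isInvertible_bilinearComp_of_projections (hdual : ∀ Λ : StrongDual 𝕜 G, ∃ u, M u = Λ)
    (hnorm : ∀ u, ∀ C : ℝ≥0, (∀ v, ‖M u v‖ ≤ C * ‖v‖) → ‖u‖ ≤ C)
    {P : E → E} (hP : ∀ u, P u ∈ S) {P' : G →L[𝕜] G} (hP' : ∀ v, P' v ∈ R)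
    (hfix : ∀ v ∈ R, P' v = v) (hadj : ∀ u, ∀ v ∈ R, M (P u) v = M u v)
    (hadj' : ∀ u ∈ S, ∀ v, M u (P' v) = M u v) :
    (M.bilinearComp S.subtypeL R.subtypeL).IsInvertible := by
  refine isInvertible_of_surjective_of_norm_le (fun Λ => ?_) (D := ‖P'‖) fun w => ?_
  -- Extend `Λ` from `R` to `G` by composing with `P'`, represent the extension by `u`, and project
  -- `u` to `S`.
  · obtain ⟨u, hu⟩ := hdual (Λ.comp (P'.codRestrict R hP'))
    refine ⟨⟨P u, hP u⟩, ContinuousLinearMap.ext fun v => ?_⟩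
    change M (P u) v = Λ v
    rw [hadj u v v.2, hu]
    exact congrArg Λ (Subtype.ext (hfix v v.2))
  -- The norm of `w` is tested on all of `G`; `P'` moves each test vector into `R` at the cost of a
  -- factor `‖P'‖`.
  · refine hnorm w (‖P'‖₊ * ‖M.bilinearComp S.subtypeL R.subtypeL w‖₊) fun v => ?_
    rw [← hadj' w w.2]
    calc ‖M w (P' v)‖ ≤ ‖M.bilinearComp S.subtypeL R.subtypeL w‖ * ‖P' v‖ :=
          (M.bilinearComp S.subtypeL R.subtypeL w).le_opNorm ⟨P' v, hP' v⟩
      _ ≤ ‖M.bilinearComp S.subtypeL R.subtypeL w‖ * (‖P'‖ * ‖v‖) := by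
          gcongr
          exact P'.le_opNorm v
      _ = _ := by push_cast; ring

end RestrictedPairing

/-! ### The pairing as an integral over the product, and the step from 3 to a scalar bound. -/

section Pairing

variable {𝕜 : Type*} [RCLike 𝕜] {A B : Type*} [MeasurableSpace A] [MeasurableSpace B]
  {μ : Measure A} {ν : Measure B}

theorem integrable_mul_of_mixedNorm_lt_top [SFinite ν]
    (p q p' q' : ℝ≥0∞) [p.HolderConjugate p'] [q.HolderConjugate q'] (hp : 1 < p) (hp_top : p < ∞)
    (hq : 1 < q) (hq_top : q < ∞) {f g : A × B → 𝕜} (hf : AEStronglyMeasurable f (μ.prod ν))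
    (hg : AEStronglyMeasurable g (μ.prod ν)) (hf' : mixedNorm p q μ ν f < ∞)
    (hg' : mixedNorm p' q' μ ν g < ∞) : Integrable (fun z => f z * g z) (μ.prod ν) := by
  refine ⟨hf.mul hg, ?_⟩
  rw [hasFiniteIntegral_iff_enorm]
  simp only [enorm_mul]
  refine (lintegral_mul_le_mixedNorm_mul_mixedNorm p q p' q' hp hp_top hq hq_top hf.enorm
    hg.enorm).trans_lt ?_
  rw [mixedNorm_enorm, mixedNorm_enorm]
  exact ENNReal.mul_lt_top hf' hg'

theorem IsRep.integrable_mul [SFinite ν] (p q p' q' : ℝ≥0∞) [Fact (1 ≤ q)] [Fact (1 ≤ q')]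
    [ENNReal.HolderConjugate p p'] [ENNReal.HolderConjugate q q'] (hp : 1 < p) (hp_top : p < ∞)
    (hq : 1 < q) (hq_top : q < ∞)
    {f g : A × B → 𝕜} {u : Lp (Lp 𝕜 q ν) p μ} {v : Lp (Lp 𝕜 q' ν) p' μ}
    (hfu : IsRep f u) (hgv : IsRep g v) (hf : AEStronglyMeasurable f (μ.prod ν))
    (hg : AEStronglyMeasurable g (μ.prod ν)) : Integrable (fun z => f z * g z) (μ.prod ν) :=
  integrable_mul_of_mixedNorm_lt_top p q p' q' hp hp_top hq hq_top hf hg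
    (by simp [hfu.mixedNorm_eq]) (by simp [hgv.mixedNorm_eq])

variable [IsProbabilityMeasure μ] [IsProbabilityMeasure ν]

/-- A function which is normed by bounded functions has finite mixed norm. -/
theorem mixedNorm_le_of_forall_integral_mul_le
    (p q p' q' : ℝ≥0∞) [p.HolderConjugate p'] [q.HolderConjugate q'] (hp : 1 < p) (hp_top : p < ∞)
    (hq : 1 < q) (hq_top : q < ∞) {f : A × B → 𝕜} (hf : Integrable f (μ.prod ν)) {C : ℝ≥0∞}
    (H : ∀ g : A × B → 𝕜, Measurable g → (∃ K : ℝ, ∀ z, ‖g z‖ ≤ K) →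
      ‖∫ z, f z * g z ∂μ.prod ν‖ₑ ≤ C * mixedNorm p' q' μ ν g) :
    mixedNorm p q μ ν f ≤ C := by
  rw [← mixedNorm_enorm]
  refine mixedNorm_le_of_forall_lintegral_mul_le p q p' q' hp hp_top hq hq_top hf.1.enorm
    fun s hs ⟨K, hK⟩ => ?_
  let f₀ := hf.1.mk f
  have hf₀ : Measurable f₀ := hf.1.stronglyMeasurable_mk.measurable
  -- Multiplying `s` by the conjugate phase of `f` makes `f g = s ‖f‖` almost everywhere. The
  -- version `f₀` makes `g` genuinely measurable, and the convention `0⁻¹ = 0` covers the zeros of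
  -- `f`.
  let g : A × B → 𝕜 := fun z => ((s z : ℝ) : 𝕜) * (starRingEnd 𝕜 (f₀ z) * ((‖f₀ z‖⁻¹ : ℝ) : 𝕜))
  have hg : Measurable g := by
    refine (RCLike.measurable_ofReal.comp hs.coe_nnreal_real).mul (.mul ?_ ?_)
    · exact RCLike.continuous_conj.measurable.comp hf₀
    · exact RCLike.measurable_ofReal.comp hf₀.norm.inv
  have hgs : ∀ z, ‖g z‖ ≤ s z := fun z => by
    simp only [g, norm_mul, RCLike.norm_ofReal, RCLike.norm_conj, NNReal.abs_eq, abs_inv,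
      abs_norm]
    exact mul_le_of_le_one_right (s z).2 mul_inv_le_one
  have hfg : ∀ᵐ z ∂μ.prod ν, f z * g z = (((s z : ℝ) * ‖f z‖ : ℝ) : 𝕜) := by
    filter_upwards [hf.1.ae_eq_mk] with z hz
    have h1 : f z * starRingEnd 𝕜 (f₀ z) = ((‖f z‖ ^ 2 : ℝ) : 𝕜) := by
      rw [show f₀ z = f z from hz.symm, RCLike.mul_conj]
      norm_cast
    have h2 : f z * g z = ((s z : ℝ) : 𝕜) * ((f z * starRingEnd 𝕜 (f₀ z)) *
        ((‖f₀ z‖⁻¹ : ℝ) : 𝕜)) := by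
      simp only [g]
      ring
    rw [h2, h1, show f₀ z = f z from hz.symm, ← RCLike.ofReal_mul, ← RCLike.ofReal_mul]
    congr 2
    rcases eq_or_ne ‖f z‖ 0 with h0 | h0
    · simp [h0]
    · field_simp
  have hsf : Integrable (fun z => (s z : ℝ) * ‖f z‖) (μ.prod ν) :=
    hf.norm.bdd_mul hs.coe_nnreal_real.aestronglyMeasurable (c := K)
      (.of_forall fun z => by simpa using hK z)
  have hint : ∫ z, f z * g z ∂μ.prod ν = ((∫ z, (s z : ℝ) * ‖f z‖ ∂μ.prod ν : ℝ) : 𝕜) := by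
    rw [integral_congr_ae hfg, integral_ofReal]
  have hnn : ∀ z, 0 ≤ (s z : ℝ) * ‖f z‖ := fun z => mul_nonneg (s z).2 (norm_nonneg _)
  calc ∫⁻ z, s z * ‖f z‖ₑ ∂μ.prod ν
      = ∫⁻ z, ENNReal.ofReal (s z * ‖f z‖) ∂μ.prod ν := by
        refine lintegral_congr fun z => ?_
        rw [ENNReal.ofReal_mul (s z).coe_nonneg, ENNReal.ofReal_coe_nnreal, ofReal_norm]
    _ = ‖∫ z, f z * g z ∂μ.prod ν‖ₑ := by
        rw [← ofReal_integral_eq_lintegral_ofReal hsf (.of_forall hnn), hint,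
          ← ofReal_norm, RCLike.norm_ofReal, abs_of_nonneg (integral_nonneg hnn)]
    _ ≤ C * mixedNorm p' q' μ ν g := H g hg ⟨K, fun z => (hgs z).trans (by simpa using hK z)⟩
    _ ≤ C * mixedNorm p' q' μ ν fun z => (s z : ℝ) := by
        gcongr
        refine mixedNorm_mono_ae (.of_forall fun z => ?_)
        rw [← ofReal_norm, ← ofReal_norm]
        exact ENNReal.ofReal_le_ofReal (by simpa using hgs z)

variable (p q p' q' : ℝ≥0∞) [Fact (1 ≤ p)] [Fact (1 ≤ q)] [Fact (1 ≤ p')] [Fact (1 ≤ q')]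
  [ENNReal.HolderConjugate p p'] [ENNReal.HolderConjugate q q']

theorem mixedPairing_eq_integral (hp : 1 < p) (hp_top : p < ∞) (hq : 1 < q) (hq_top : q < ∞)
    {f g : A × B → 𝕜} {u : Lp (Lp 𝕜 q ν) p μ} {v : Lp (Lp 𝕜 q' ν) p' μ}
    (hfu : IsRep f u) (hgv : IsRep g v) (hf : AEStronglyMeasurable f (μ.prod ν))
    (hg : AEStronglyMeasurable g (μ.prod ν)) :
    mixedPairing 𝕜 μ ν p q p' q' u v = ∫ z, f z * g z ∂μ.prod ν := by
  rw [mixedPairing_apply, integral_prod _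
    (hfu.integrable_mul p q p' q' hp hp_top hq hq_top hgv hf hg)]
  refine integral_congr_ae ?_
  filter_upwards [hfu, hgv] with a ha hb
  refine integral_congr_ae ?_
  filter_upwards [ha, hb] with b ha hb
  rw [ha, hb]

theorem IsRep.integrable_of_aestronglyMeasurable {p q : ℝ≥0∞} [Fact (1 ≤ p)] [Fact (1 ≤ q)]
    {X : Type*} [NormedAddCommGroup X] {f : A × B → X}
    {u : Lp (Lp X q ν) p μ} (hfu : IsRep f u) (hf : AEStronglyMeasurable f (μ.prod ν)) :
    Integrable f (μ.prod ν) :=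
  integrable_of_mixedNorm_lt_top (p := p) (q := q) hf Fact.out Fact.out
    (by simp [hfu.mixedNorm_eq])

/-- Invertibility yields an `F`-measurable `w`, controlled by `s`, that pairs with `F`-measurable
functions as `s` does. Indicators of sets in `F` are admissible test functions, so `w` has the
defining property of `E s`. -/
theorem condExpMixedBound_of_isInvertible_phi {F : MeasurableSpace (A × B)}
    (hF : F ≤ Prod.instMeasurableSpace)
    (hp : 1 < p) (hp_top : p < ∞) (hq : 1 < q) (hq_top : q < ∞)
    (h : (phi 𝕜 F μ ν p q p' q').IsInvertible) : CondExpMixedBound F μ ν p q := by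
  have : p'.HolderConjugate p := .symm
  have : q'.HolderConjugate q := .symm
  have hp'_top : p' < ∞ := (ENNReal.HolderConjugate.lt_top_iff_one_lt p' p).2 hp
  have hq'_top : q' < ∞ := (ENNReal.HolderConjugate.lt_top_iff_one_lt q' q).2 hq
  obtain ⟨D, hD⟩ := exists_mem_of_isInvertible_bilinearComp h
  refine ⟨D, fun s hs ⟨K, hK⟩ => ?_⟩
  have hsm : AEStronglyMeasurable[Prod.instMeasurableSpace] (fun z => (s z : ℝ)) (μ.prod ν) :=
    hs.coe_nnreal_real.aestronglyMeasurable
  have hsi : Integrable (fun z => (s z : ℝ)) (μ.prod ν) :=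
    .of_bound hsm K (.of_forall fun z => by simpa using hK z)
  let T : ℝ →L[ℝ] 𝕜 := RCLike.ofRealCLM
  have hTN : ∀ g : A × B → ℝ, mixedNorm p q μ ν (T ∘ g) = mixedNorm p q μ ν g := fun g =>
    mixedNorm_congr_enorm_ae (.of_forall fun z => by simp [T, ← ofReal_norm])
  have hTs : Integrable (T ∘ fun z => (s z : ℝ)) (μ.prod ν) := T.integrable_comp hsi
  obtain ⟨u, hu⟩ := exists_isRep_of_mixedNorm_lt_top hp_top.ne hq_top.ne hTs.1 (by
    rw [hTN]
    exact mixedNorm_lt_top_of_bound (C := K) (.of_forall fun z => by simpa using hK z))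
  obtain ⟨w, ⟨g, hg, hgw⟩, hw, hM⟩ := hD u
  have hgm : AEStronglyMeasurable[Prod.instMeasurableSpace] g (μ.prod ν) :=
    (hg.mono hF).aestronglyMeasurable
  have hgi := hgw.integrable_of_aestronglyMeasurable hgm
  have key : g =ᵐ[μ.prod ν] (μ.prod ν)[T ∘ fun z => (s z : ℝ) | F] := by
    refine ae_eq_condExp_of_forall_setIntegral_eq hF hTs (fun _ _ _ => hgi.integrableOn)
      (fun t ht _ => ?_) hg.aestronglyMeasurable
    have h1m : StronglyMeasurable[F] (t.indicator fun _ => (1 : 𝕜)) :=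
      stronglyMeasurable_const.indicator ht
    have h1m' : AEStronglyMeasurable[Prod.instMeasurableSpace] (t.indicator fun _ => (1 : 𝕜))
        (μ.prod ν) := (h1m.mono hF).aestronglyMeasurable
    obtain ⟨v, hv⟩ := exists_isRep_of_mixedNorm_lt_top (p := p') (q := q') hp'_top.ne hq'_top.ne
      h1m' (mixedNorm_lt_top_of_bound (C := 1) (.of_forall fun z => by
        by_cases hz : z ∈ t <;> simp [hz]))
    have hmul : ∀ f : A × B → 𝕜, ∫ z, f z * t.indicator (fun _ => (1 : 𝕜)) z ∂μ.prod ν =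
        ∫ z in t, f z ∂μ.prod ν := fun f => by
      rw [← integral_indicator (hF _ ht)]
      congr 1 with z
      by_cases hz : z ∈ t <;> simp [hz]
    have e1 := hM v ⟨_, h1m, hv⟩
    rw [mixedPairing_eq_integral p q p' q' hp hp_top hq hq_top hgw hv hgm h1m',
      mixedPairing_eq_integral p q p' q' hp hp_top hq hq_top hu hv hTs.1 h1m', hmul, hmul] at e1
    exact e1
  rw [← hTN, ← hTN (fun z => (s z : ℝ)), hu.mixedNorm_eq,
    (hgw.congr_ae (key.trans (T.comp_condExp_comm hsi).symm)).mixedNorm_eq,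
    enorm_eq_nnnorm, enorm_eq_nnnorm]
  exact_mod_cast hw

end Pairing

/-! ### Integral densities of functionals on `L^m` of a finite measure. -/

section LpFunctional

variable {Ω 𝕜 : Type*} [RCLike 𝕜] [MeasurableSpace Ω] {P : Measure Ω} [IsFiniteMeasure P]
  {m : ℝ≥0∞}

theorem indicatorConstLp_biUnion_finset {f : ℕ → Set Ω} (hf : ∀ i, MeasurableSet (f i))
    (hd : Pairwise (Function.onFun Disjoint f)) (s : Finset ℕ) (c : 𝕜) :
    indicatorConstLp m (s.measurableSet_biUnion fun i _ => hf i) (measure_ne_top P _) c =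
      ∑ i ∈ s, indicatorConstLp m (hf i) (measure_ne_top P _) c := by
  classical
  induction s using Finset.induction_on with
  | empty => simp
  | insert i s his ih =>
    have hdis : Disjoint (f i) (⋃ j ∈ s, f j) := by
      simp only [Set.disjoint_iUnion_right]
      exact fun j hj => hd fun h => his (h ▸ hj)
    rw [Finset.sum_insert his, ← ih, ← indicatorConstLp_disjoint_union _ _ _ _ hdis]
    congr! 1
    simp

variable [Fact (1 ≤ m)]

theorem hasSum_indicatorConstLp_iUnion (hm : m ≠ ∞) {f : ℕ → Set Ω}
    (hf : ∀ i, MeasurableSet (f i)) (hd : Pairwise (Function.onFun Disjoint f)) (c : 𝕜) :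
    HasSum (fun i => indicatorConstLp m (hf i) (measure_ne_top P _) c)
      (indicatorConstLp m (MeasurableSet.iUnion hf) (measure_ne_top P _) c) := by
  have key : Tendsto (fun s : Finset ℕ => P ((⋃ i ∈ s, f i) ∆ ⋃ i, f i)) atTop (𝓝 0) := by
    have h1 : HasSum (fun i => P (f i)) (P (⋃ i, f i)) := by
      rw [measure_iUnion hd hf]
      exact ENNReal.summable.hasSum
    have h2 : Tendsto (fun s : Finset ℕ => P (⋃ i, f i) - ∑ i ∈ s, P (f i)) atTop (𝓝 0) := by
      simpa using ENNReal.Tendsto.sub (tendsto_const_nhds (x := P (⋃ i, f i))) h1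
        (Or.inl (measure_ne_top P _))
    refine h2.congr fun s => ?_
    have hsub : (⋃ i ∈ s, f i) ⊆ ⋃ i, f i := Set.iUnion₂_subset fun i _ => Set.subset_iUnion f i
    rw [symmDiff_of_le hsub, measure_sdiff hsub
      (s.measurableSet_biUnion fun i _ => hf i).nullMeasurableSet (measure_ne_top P _),
      measure_biUnion_finset (hd.set_pairwise _) fun i _ => hf i]
  refine (tendsto_indicatorConstLp_set (p := m) (c := c) (hs := MeasurableSet.iUnion hf)
    (hμs := measure_ne_top P _) (ht := fun s : Finset ℕ => s.measurableSet_biUnion fun i _ => hf i)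
    (hμt := fun s => measure_ne_top P _) hm key).congr fun s => ?_
  exact indicatorConstLp_biUnion_finset hf hd s c

open scoped Classical in
/-- A real-linear functional on `L^m` restricted to indicators, as a signed measure. -/
noncomputable def signedMeasureOfFunctional (hm : m ≠ ∞) (T : Lp 𝕜 m P →L[ℝ] ℝ) :
    SignedMeasure Ω where
  measureOf' S := if hS : MeasurableSet S then
    T (indicatorConstLp m hS (measure_ne_top P S) 1) else 0
  empty' := by simp
  not_measurable' S hS := by simp [hS]
  m_iUnion' f hf hd := by
    simp only [hf, MeasurableSet.iUnion hf, dif_pos]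
    exact (hasSum_indicatorConstLp_iUnion hm hf hd 1).mapL T

/-- Radon–Nikodym: the signed measure of `T` is absolutely continuous because the indicator of a
null set is zero in `L^m`. -/
theorem exists_integrable_forall_eq_setIntegral (hm : m ≠ ∞) (T : Lp 𝕜 m P →L[ℝ] ℝ) :
    ∃ g : Ω → ℝ, Integrable g P ∧ ∀ S (hS : MeasurableSet S),
      T (indicatorConstLp m hS (measure_ne_top P S) 1) = ∫ x in S, g x ∂P := by
  let s := signedMeasureOfFunctional hm T
  have hs : ∀ S (hS : MeasurableSet S), s S = T (indicatorConstLp m hS (measure_ne_top P S) 1) :=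
    fun S hS => dif_pos hS
  have hac : s ≪ᵥ P.toENNRealVectorMeasure := by
    refine VectorMeasure.AbsolutelyContinuous.mk fun S hS h0 => ?_
    rw [Measure.toENNRealVectorMeasure_apply_measurable hS] at h0
    rw [hs S hS]
    have : indicatorConstLp m hS (measure_ne_top P S) (1 : 𝕜) = 0 := by
      refine Lp.ext ?_
      filter_upwards [indicatorConstLp_coeFn (p := m) (hs := hS) (hμs := measure_ne_top P S)
        (c := (1 : 𝕜)), Lp.coeFn_zero 𝕜 m P, measure_eq_zero_iff_ae_notMem.1 h0] with x h1 h2 h3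
      rw [h1, h2]
      simp [h3]
    rw [this, map_zero]
  refine ⟨s.rnDeriv P, SignedMeasure.integrable_rnDeriv s P, fun S hS => ?_⟩
  rw [← hs S hS, ← withDensityᵥ_apply (SignedMeasure.integrable_rnDeriv s P) hS,
    SignedMeasure.withDensityᵥ_rnDeriv_eq s P hac]

/-- A functional on `L^m` is given by an integrable density, on bounded functions. -/
theorem exists_integrable_forall_bounded_eq_integral (hm : m ≠ ∞) (Ψ : StrongDual 𝕜 (Lp 𝕜 m P)) :
    ∃ g : Ω → 𝕜, Integrable g P ∧ ∀ (f : Ω → 𝕜) (_ : Measurable f) (K : ℝ) (_ : ∀ x, ‖f x‖ ≤ K)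
      (h : MemLp f m P), Ψ (h.toLp f) = ∫ x, g x * f x ∂P := by
  -- Signed measures are real, so the real and imaginary parts of `Ψ` are treated separately.
  obtain ⟨g₁, hg₁, h₁⟩ := exists_integrable_forall_eq_setIntegral hm
    (RCLike.reCLM ∘L Ψ.restrictScalars ℝ)
  obtain ⟨g₂, hg₂, h₂⟩ := exists_integrable_forall_eq_setIntegral hm
    (RCLike.imCLM ∘L Ψ.restrictScalars ℝ)
  let g : Ω → 𝕜 := fun x => (g₁ x : 𝕜) + (g₂ x : 𝕜) * RCLike.I
  have hg : Integrable g P := hg₁.ofReal.add (hg₂.ofReal.mul_const _)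
  have hset : ∀ S (hS : MeasurableSet S),
      Ψ (indicatorConstLp m hS (measure_ne_top P S) 1) = ∫ x in S, g x ∂P := by
    intro S hS
    have e1 : RCLike.re (Ψ (indicatorConstLp m hS (measure_ne_top P S) 1)) = _ := h₁ S hS
    have e2 : RCLike.im (Ψ (indicatorConstLp m hS (measure_ne_top P S) 1)) = _ := h₂ S hS
    rw [← RCLike.re_add_im (Ψ _), e1, e2, integral_add hg₁.ofReal.restrict
      (hg₂.ofReal.mul_const _).restrict, integral_mul_const, integral_ofReal, integral_ofReal]
  have hsimple : ∀ (f : SimpleFunc Ω 𝕜) (h : MemLp f m P),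
      Ψ (h.toLp f) = ∫ x, g x * f x ∂P := by
    intro f
    induction f using SimpleFunc.induction with
    | const c hS =>
      rename_i S
      intro h
      have e : h.toLp _ = c • indicatorConstLp m hS (measure_ne_top P S) (1 : 𝕜) := by
        refine Lp.ext ?_
        filter_upwards [h.coeFn_toLp, Lp.coeFn_smul c
          (indicatorConstLp m hS (measure_ne_top P S) (1 : 𝕜)),
          indicatorConstLp_coeFn (p := m) (hs := hS) (hμs := measure_ne_top P S)
          (c := (1 : 𝕜))] with x h1 h2 h3
        rw [h1, h2, Pi.smul_apply, h3]
        by_cases hx : x ∈ S <;> simp [hx]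
      rw [e, map_smul, hset S hS, smul_eq_mul, ← integral_const_mul, ← integral_indicator hS]
      congr 1 with x
      by_cases hx : x ∈ S <;> simp [hx, mul_comm]
    | add hd hf₁ hf₂ =>
      rename_i f₁ f₂
      intro h
      have hb : ∀ f : SimpleFunc Ω 𝕜, MemLp f m P := fun f => f.memLp_of_isFiniteMeasure m P
      have hi : ∀ f : SimpleFunc Ω 𝕜, Integrable (fun x => g x * f x) P := fun f => by
        obtain ⟨K, hK⟩ := f.exists_forall_norm_le
        exact hg.mul_bdd (c := K) f.stronglyMeasurable.aestronglyMeasurable (.of_forall hK)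
      have e : h.toLp _ = (hb f₁).toLp f₁ + (hb f₂).toLp f₂ := by
        rw [← MemLp.toLp_add]
        rfl
      rw [e, map_add, hf₁ (hb f₁), hf₂ (hb f₂), ← integral_add (hi f₁) (hi f₂)]
      congr 1 with x
      simp [mul_add]
  refine ⟨g, hg, fun f hf K hK h => ?_⟩
  have t1 := (Ψ.continuous.tendsto _).comp (SimpleFunc.tendsto_approxOn_range_Lp hm hf h)
  refine tendsto_nhds_unique t1 ?_
  have e : ∀ n, (Ψ ∘ fun n => (SimpleFunc.memLp_approxOn_range hf h n).toLp
      (SimpleFunc.approxOn f hf (Set.range f ∪ {0}) 0 (by simp) n)) n =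
      ∫ x, g x * SimpleFunc.approxOn f hf (Set.range f ∪ {0}) 0 (by simp) n x ∂P :=
    fun n => hsimple _ _
  refine Tendsto.congr (fun n => (e n).symm) ?_
  -- The density `g` is only known to be integrable, so the bound on `f` provides the domination:
  -- the approximants satisfy `‖f_n‖ ≤ ‖f‖ + ‖f‖ ≤ K + K`.
  refine tendsto_integral_of_dominated_convergence (fun x => ‖g x‖ * (K + K)) (fun n => ?_)
    (hg.norm.mul_const _) (fun n => .of_forall fun x => ?_) (.of_forall fun x => ?_)
  · exact hg.1.mul (SimpleFunc.stronglyMeasurable _).aestronglyMeasurable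
  · rw [norm_mul]
    gcongr
    exact (SimpleFunc.norm_approxOn_zero_le hf (by simp) x n).trans (add_le_add (hK x) (hK x))
  · exact (SimpleFunc.tendsto_approxOn hf (by simp) (subset_closure (by simp))).const_mul _

end LpFunctional

/-! ### The dual of the mixed-norm space. -/

section MixedDual

variable {𝕜 : Type*} [RCLike 𝕜] {A B : Type*} [MeasurableSpace A] [MeasurableSpace B]
  {μ : Measure A} {ν : Measure B}

theorem continuous_indicatorConstLp {α E : Type*} [MeasurableSpace α] {m : Measure α}
    [NormedAddCommGroup E] {p : ℝ≥0∞} [Fact (1 ≤ p)] {s : Set α} (hs : MeasurableSet s)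
    (hms : m s ≠ ∞) : Continuous fun c : E => indicatorConstLp p hs hms c := by
  refine (LipschitzWith.of_dist_le_mul
    (K := ⟨m.real s ^ (1 / p.toReal), by positivity⟩) fun c d => ?_).continuous
  rw [dist_eq_norm, dist_eq_norm, indicatorConstLp_sub, mul_comm]
  exact norm_indicatorConstLp_le

/-- A functional on `L^p(μ; L^q(ν))` is determined by its values on elements with a bounded
measurable representative. -/
theorem functional_ext {p q : ℝ≥0∞} [Fact (1 ≤ p)] [Fact (1 ≤ q)] (hp : p ≠ ∞) (hq : q ≠ ∞)
    {Λ₁ Λ₂ : StrongDual 𝕜 (Lp (Lp 𝕜 q ν) p μ)}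
    (H : ∀ v f, Measurable f → (∃ K : ℝ, ∀ z, ‖f z‖ ≤ K) → IsRep f v → Λ₁ v = Λ₂ v) :
    Λ₁ = Λ₂ := by
  ext v
  induction v using Lp.induction hp with
  | indicatorConst c hs hμs =>
    rename_i s
    rw [Lp.simpleFunc.coe_indicatorConst]
    -- A second density argument, now in `L^q(ν)`, reduces the values of step functions to
    -- indicators, leaving scalar multiples of indicators of rectangles.
    induction c using Lp.induction hq with
    | indicatorConst d ht hνt =>
      rename_i t
      rw [Lp.simpleFunc.coe_indicatorConst]
      refine H _ _ ?_ ⟨‖d‖, fun z => ?_⟩ (isRep_indicatorConstLp hs hμs.ne indicatorConstLp_coeFn)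
      · exact ((measurable_const.indicator ht).comp measurable_snd).indicator (hs.prod .univ)
      · refine (norm_indicator_le_norm_self _ _).trans (norm_indicator_le_norm_self _ _)
    | add hf hg _ h1 h2 =>
      rw [← indicatorConstLp_add, map_add, map_add, h1, h2]
    | isClosed =>
      have hc : Continuous fun c : Lp 𝕜 q ν => indicatorConstLp p hs hμs.ne c :=
        continuous_indicatorConstLp hs hμs.ne
      exact isClosed_eq (Λ₁.continuous.comp hc) (Λ₂.continuous.comp hc)
  | add hf hg _ h1 h2 => rw [map_add, map_add, h1, h2]
  | isClosed => exact isClosed_eq Λ₁.continuous Λ₂.continuous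

variable [IsProbabilityMeasure μ] [IsProbabilityMeasure ν]

/-- The embedding of `L^m(μ × ν)` into `L^p(μ; L^q(ν))` for `m = max p q`. -/
theorem exists_continuousLinearMap_isRep {p q : ℝ≥0∞} [Fact (1 ≤ p)] [Fact (1 ≤ q)] (hp : p ≠ ∞)
    (hq : q ≠ ∞) [Fact (1 ≤ max p q)] :
    ∃ J : Lp 𝕜 (max p q) (μ.prod ν) →L[𝕜] Lp (Lp 𝕜 q ν) p μ, 
      ∀ f : Lp 𝕜 (max p q) (μ.prod ν), IsRep f (J f) := by
  have hle : ∀ f : Lp 𝕜 (max p q) (μ.prod ν), mixedNorm p q μ ν f ≤ ‖f‖ₑ := fun f => by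
    rw [Lp.enorm_def]
    exact mixedNorm_le_eLpNorm_max (Lp.aestronglyMeasurable f) hp
      (zero_lt_one.trans_le Fact.out).ne' hq
  choose J hJ using fun f : Lp 𝕜 (max p q) (μ.prod ν) =>
    exists_isRep_of_mixedNorm_lt_top hp hq (Lp.aestronglyMeasurable f)
      ((hle f).trans_lt (by simp))
  let L : Lp 𝕜 (max p q) (μ.prod ν) →ₗ[𝕜] Lp (Lp 𝕜 q ν) p μ :=
    { toFun := J
      map_add' := fun f g =>
        (hJ (f + g)).eq (((hJ f).add (hJ g)).congr_ae (Lp.coeFn_add f g).symm)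
      map_smul' := fun c f => (hJ (c • f)).eq (((hJ f).smul c).congr_ae (Lp.coeFn_smul c f).symm) }
  refine ⟨L.mkContinuous 1 fun f => ?_, hJ⟩
  have := hle f
  rw [(hJ f).mixedNorm_eq, enorm_eq_nnnorm, enorm_eq_nnnorm] at this
  rw [one_mul]
  exact_mod_cast this

/-- For conjugate exponents, `L^p(μ; L^q(ν))` represents the dual of the conjugate mixed space. -/
theorem exists_eq_mixedPairing
    (p q p' q' : ℝ≥0∞) [Fact (1 ≤ p)] [Fact (1 ≤ q)] [Fact (1 ≤ p')] [Fact (1 ≤ q')]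
    [ENNReal.HolderConjugate p p'] [ENNReal.HolderConjugate q q']
    (hp : 1 < p) (hp_top : p < ∞) (hq : 1 < q) (hq_top : q < ∞)
    (Λ : StrongDual 𝕜 (Lp (Lp 𝕜 q' ν) p' μ)) : ∃ u, mixedPairing 𝕜 μ ν p q p' q' u = Λ := by
  have : p'.HolderConjugate p := .symm
  have : q'.HolderConjugate q := .symm
  have hp'_top : p' < ∞ := (ENNReal.HolderConjugate.lt_top_iff_one_lt p' p).2 hp
  have hq'_top : q' < ∞ := (ENNReal.HolderConjugate.lt_top_iff_one_lt q' q).2 hq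
  have : Fact (1 ≤ max p' q') := ⟨le_max_of_le_left Fact.out⟩
  have hm : max p' q' ≠ ∞ := (max_lt hp'_top hq'_top).ne
  obtain ⟨J, hJ⟩ := exists_continuousLinearMap_isRep (𝕜 := 𝕜) (μ := μ) (ν := ν) hp'_top.ne
    hq'_top.ne
  -- Pulling `Λ` back to `L^m(μ × ν)` with `m = max p' q'` makes the one-variable Radon–Nikodym
  -- argument available.
  obtain ⟨g, hg, hgΛ⟩ := exists_integrable_forall_bounded_eq_integral hm (Λ.comp J)
  have hval : ∀ v f, Measurable f → (∃ K : ℝ, ∀ z, ‖f z‖ ≤ K) → IsRep f v →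
      Λ v = ∫ z, g z * f z ∂μ.prod ν := by
    rintro v f hf ⟨K, hK⟩ hfv
    have hmem : MemLp f (max p' q') (μ.prod ν) :=
      MemLp.of_bound hf.aestronglyMeasurable K (.of_forall hK)
    rw [← hgΛ f hf K hK hmem, ContinuousLinearMap.comp_apply]
    congr 1
    exact hfv.eq ((hJ _).congr_ae hmem.coeFn_toLp)
  -- A priori `g` is only integrable; converse Hölder, tested on bounded functions, places it in the
  -- mixed space.
  have hN : mixedNorm p q μ ν g ≤ ‖Λ‖ₑ := by
    refine mixedNorm_le_of_forall_integral_mul_le p q p' q' hp hp_top hq hq_top hg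
      fun f hf ⟨K, hK⟩ => ?_
    obtain ⟨v, hv⟩ := exists_isRep_of_mixedNorm_lt_top (p := p') (q := q') hp'_top.ne hq'_top.ne
      hf.aestronglyMeasurable (mixedNorm_lt_top_of_bound (μ := μ) (ν := ν) (.of_forall hK))
    rw [← hval v f hf ⟨K, hK⟩ hv, hv.mixedNorm_eq]
    exact Λ.le_opENorm v
  obtain ⟨u, hu⟩ := exists_isRep_of_mixedNorm_lt_top hp_top.ne hq_top.ne hg.1
    (hN.trans_lt (by simp))
  refine ⟨u, functional_ext hp'_top.ne hq'_top.ne fun v f hf hK hfv => ?_⟩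
  rw [hval v f hf hK hfv, mixedPairing_eq_integral p q p' q' hp hp_top hq hq_top hu hfv hg.1
    hf.aestronglyMeasurable]

theorem norm_le_of_forall_norm_mixedPairing_le
    (p q p' q' : ℝ≥0∞) [Fact (1 ≤ p)] [Fact (1 ≤ q)] [Fact (1 ≤ p')] [Fact (1 ≤ q')]
    [ENNReal.HolderConjugate p p'] [ENNReal.HolderConjugate q q']
    (hp : 1 < p) (hp_top : p < ∞) (hq : 1 < q) (hq_top : q < ∞)
    (u : Lp (Lp 𝕜 q ν) p μ) (C : ℝ≥0)
    (h : ∀ v, ‖mixedPairing 𝕜 μ ν p q p' q' u v‖ ≤ C * ‖v‖) : ‖u‖ ≤ C := by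
  have : p'.HolderConjugate p := .symm
  have : q'.HolderConjugate q := .symm
  have hp'_top : p' < ∞ := (ENNReal.HolderConjugate.lt_top_iff_one_lt p' p).2 hp
  have hq'_top : q' < ∞ := (ENNReal.HolderConjugate.lt_top_iff_one_lt q' q).2 hq
  obtain ⟨f, hf, hfu⟩ := exists_integrable_isRep hp_top.ne u
  have hN : mixedNorm p q μ ν f ≤ C := by
    refine mixedNorm_le_of_forall_integral_mul_le p q p' q' hp hp_top hq hq_top hf
      fun g hg ⟨K, hK⟩ => ?_
    obtain ⟨v, hv⟩ := exists_isRep_of_mixedNorm_lt_top (p := p') (q := q') hp'_top.ne hq'_top.ne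
      hg.aestronglyMeasurable (mixedNorm_lt_top_of_bound (μ := μ) (ν := ν) (.of_forall hK))
    rw [← mixedPairing_eq_integral p q p' q' hp hp_top hq hq_top hfu hv hf.1
      hg.aestronglyMeasurable, hv.mixedNorm_eq, enorm_eq_nnnorm, enorm_eq_nnnorm]
    exact_mod_cast h v
  rw [hfu.mixedNorm_eq, enorm_eq_nnnorm] at hN
  exact_mod_cast hN

end MixedDual

/-! ### Assembling the equivalence. -/

section Main

variable {𝕜 : Type*} [RCLike 𝕜] {A B : Type*} [MeasurableSpace A] [MeasurableSpace B]
  {μ : Measure A} {ν : Measure B} [IsProbabilityMeasure μ] [IsProbabilityMeasure ν]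

/-- The two restrictions of `E` are the mutually adjoint projections required by
`isInvertible_bilinearComp_of_projections`; adjointness is the rule that an `F`-measurable factor
can be pulled out of `E`. -/
theorem isInvertible_phi {F : MeasurableSpace (A × B)} (hF : F ≤ Prod.instMeasurableSpace)
    (p q p' q' : ℝ≥0∞) [Fact (1 ≤ p)] [Fact (1 ≤ q)] [Fact (1 ≤ p')] [Fact (1 ≤ q')]
    [ENNReal.HolderConjugate p p'] [ENNReal.HolderConjugate q q']
    (hp : 1 < p) (hp_top : p < ∞) (hq : 1 < q) (hq_top : q < ∞)
    (h : CondExpRestrictsToProjection 𝕜 F μ ν 𝕜 p q)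
    (h' : CondExpRestrictsToProjection 𝕜 F μ ν 𝕜 p' q') :
    (phi 𝕜 F μ ν p q p' q').IsInvertible := by
  have : p'.HolderConjugate p := .symm
  have : q'.HolderConjugate q := .symm
  have hp'_top : p' < ∞ := (ENNReal.HolderConjugate.lt_top_iff_one_lt p' p).2 hp
  have hq'_top : q' < ∞ := (ENNReal.HolderConjugate.lt_top_iff_one_lt q' q).2 hq
  obtain ⟨P, hP⟩ := h.exists_isRep
  obtain ⟨P', hP'⟩ := h'.exists_isRep
  have hmem : ∀ u, P u ∈ LpF 𝕜 F μ ν 𝕜 p q := fun u => by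
    obtain ⟨f, hf, hfu⟩ := exists_integrable_isRep hp_top.ne u
    exact ⟨_, stronglyMeasurable_condExp, hP u f hf hfu⟩
  have hmem' : ∀ v, P' v ∈ LpF 𝕜 F μ ν 𝕜 p' q' := fun v => by
    obtain ⟨f, hf, hfv⟩ := exists_integrable_isRep hp'_top.ne v
    exact ⟨_, stronglyMeasurable_condExp, hP' v f hf hfv⟩
  have aesm : ∀ {f : A × B → 𝕜}, StronglyMeasurable[F] f →
      AEStronglyMeasurable[Prod.instMeasurableSpace] f (μ.prod ν) := fun hf =>
    (hf.mono hF).aestronglyMeasurable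
  refine isInvertible_bilinearComp_of_projections
    (exists_eq_mixedPairing p q p' q' hp hp_top hq hq_top)
    (norm_le_of_forall_norm_mixedPairing_le p q p' q' hp hp_top hq hq_top) hmem hmem' ?_ ?_ ?_
  · rintro v ⟨g, hg, hgv⟩
    have hgi := hgv.integrable_of_aestronglyMeasurable (aesm hg)
    refine (hP' v g hgi hgv).eq ?_
    rwa [condExp_of_stronglyMeasurable hF hg hgi]
  · rintro u v ⟨g, hg, hgv⟩
    obtain ⟨f, hf, hfu⟩ := exists_integrable_isRep hp_top.ne u
    have hfg := hfu.integrable_mul p q p' q' hp hp_top hq hq_top hgv hf.1 (aesm hg)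
    rw [mixedPairing_eq_integral p q p' q' hp hp_top hq hq_top (hP u f hf hfu) hgv
      integrable_condExp.1 (aesm hg), integral_condExp_mul_eq hF hg hf hfg,
      ← mixedPairing_eq_integral p q p' q' hp hp_top hq hq_top hfu hgv hf.1 (aesm hg)]
  · rintro u ⟨f, hf, hfu⟩ v
    obtain ⟨g, hg, hgv⟩ := exists_integrable_isRep hp'_top.ne v
    have hgf : Integrable (fun z => g z * f z) (μ.prod ν) := by
      simpa only [mul_comm] using
        hfu.integrable_mul p q p' q' hp hp_top hq hq_top hgv (aesm hf) hg.1
    rw [mixedPairing_eq_integral p q p' q' hp hp_top hq hq_top hfu (hP' v g hg hgv)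
      (aesm hf) integrable_condExp.1,
      mixedPairing_eq_integral p q p' q' hp hp_top hq hq_top hfu hgv (aesm hf) hg.1]
    simp only [mul_comm (f _)]
    exact integral_condExp_mul_eq hF hf hg hgf

end Main

theorem theorem2 {𝕜 : Type*} [RCLike 𝕜] {A B : Type*} [MeasurableSpace A] [MeasurableSpace B]
    (μ : Measure A) [IsProbabilityMeasure μ] (ν : Measure B) [IsProbabilityMeasure ν]
    (F : MeasurableSpace (A × B)) (hF : F ≤ Prod.instMeasurableSpace)
    {X : Type*} [NormedAddCommGroup X] [NormedSpace ℝ X] [NormedSpace 𝕜 X] [IsScalarTower ℝ 𝕜 X]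
    [CompleteSpace X] [Nontrivial X]
    (p q p' q' : ℝ≥0∞) [Fact (1 ≤ p)] [Fact (1 ≤ q)] [Fact (1 ≤ p')] [Fact (1 ≤ q')]
    [ENNReal.HolderConjugate p p'] [ENNReal.HolderConjugate q q']
    (hp : 1 < p) (hp_top : p < ∞) (hq : 1 < q) (hq_top : q < ∞) :
    List.TFAE [
      CondExpRestrictsToProjection 𝕜 F μ ν X p q,
      CondExpRestrictsToProjection 𝕜 F μ ν X p' q',
      -- `f ↦ φ_f` is a linear homeomorphism
      (phi 𝕜 F μ ν p q p' q').IsInvertible] := by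
  have hsp : p'.HolderConjugate p := .symm
  have hsq : q'.HolderConjugate q := .symm
  have hp' : 1 < p' := (ENNReal.HolderConjugate.lt_top_iff_one_lt p p').1 hp_top
  have hq' : 1 < q' := (ENNReal.HolderConjugate.lt_top_iff_one_lt q q').1 hq_top
  have hp'_top : p' < ∞ := (ENNReal.HolderConjugate.lt_top_iff_one_lt p' p).2 hp
  have hq'_top : q' < ∞ := (ENNReal.HolderConjugate.lt_top_iff_one_lt q' q).2 hq
  tfae_have 1 → 2 := fun h =>
    condExpRestrictsToProjection_of_conjugate hF p q hp' hp'_top hq' hq'_top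
      (h.condExpMixedBound hp_top.ne hq_top.ne)
  -- The hypothesis concerns `X`, while `φ` concerns scalars. One duality step gives the scalar case
  -- for `p, q`, a second one for `p', q'`.
  tfae_have 2 → 3 := fun h => by
    have hb' := h.condExpMixedBound hp'_top.ne hq'_top.ne
    have h1 : CondExpRestrictsToProjection 𝕜 F μ ν 𝕜 p q :=
      condExpRestrictsToProjection_of_conjugate hF p' q' hp hp_top hq hq_top hb'
    exact isInvertible_phi hF p q p' q' hp hp_top hq hq_top h1
      (condExpRestrictsToProjection_of_conjugate hF p q hp' hp'_top hq' hq'_top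
        (h1.condExpMixedBound hp_top.ne hq_top.ne))
  -- The scalar bound is for `p, q` and each duality step swaps the exponents, so the route to `X`
  -- with `p, q` goes through `p', q'`.
  tfae_have 3 → 1 := fun h => by
    have h2 : CondExpRestrictsToProjection 𝕜 F μ ν X p' q' :=
      condExpRestrictsToProjection_of_conjugate hF p q hp' hp'_top hq' hq'_top
        (condExpMixedBound_of_isInvertible_phi p q p' q' hF hp hp_top hq hq_top h)
    exact condExpRestrictsToProjection_of_conjugate hF p' q' hp hp_top hq hq_top
      (h2.condExpMixedBound hp'_top.ne hq'_top.ne)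
  tfae_finish
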